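/- Consider the on-line regression protocol: in rounds $n=1,2,\dots$ Reality announces a signal $x_n\in\mathbb R$, Predictor announces $\mu_n\in\mathbb R$ depending only on $x_1,y_1,\dots,x_{n-1},y_{n-1},x_n$, and Reality announces $y_n\in[-1,1]$. For $h>0$ let $A_h$ be the space of $2\pi$-periodic functions $\mathbb R\to\mathbb R$ that can be analytically continued to the strip $\{z\in\mathbb C:|\operatorname{Im}z|\le h\}$, normed by the supremum of the modulus of the continuation over the strip, and let $U$ be its closed unit ball. The aggregating-algorithm (AA) mixture of countably many strategies $S_i$ with positive weights $w_i$ summing to $1$ predicts in each round the average of the predictions of the $S_i$ with respect to the normalised weights proportional to $w_ie^{-\ell_i/8}$, where $\ell_i$ is the cumulative quadratic loss of $S_i$ over the previous rounds. The strategy for Predictor constructed for $A_h$ is the following: for all $i,j\ge1$ choose a $2^{-j}$-net $T_{i,j}\subseteq 2^iU$ of $2^iU$ in the uniform distance with the minimum number of elements (finite nets exist); for each $i$ let $S_i$ be the AA mixture of all elements of all $T_{i,j}$, $j\ge1$, truncated to $[-1,1]$, each element of $T_{i,j}$ having weight $\frac{6}{\pi^2}j^{-2}/|T_{i,j}|$;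 finally take the AA mixture of $S_1,S_2,\dots$ with weights $\frac{6}{\pi^2}i^{-2}$. There is a universal constant $C>0$ such that the following holds for every $h>0$ and for every choice of the nets $T_{i,j}$. Let $k\ge0$ be an integer, $\alpha\in(0,1]$, $c>0$, $s:=k+\alpha$, and let $F:\mathbb R\to\mathbb R$ be a $2\pi$-periodic function whose $k$th derivative exists everywhere and is Hölder continuous of order $\alpha$ with coefficient $c$, i.e. $|F^{(k)}(u)-F^{(k)}(v)|\le c|u-v|^{\alpha}$ for all $u,v$. Then the strategy constructed for $A_h$ guarantees $$\sum_{n=1}^N(y_n-\mu_n)^2\le\sum_{n=1}^N(y_n-F(x_n))^2+C\,h^{\frac{s}{s+2}}c^{\frac{2}{s+2}}N^{\frac{2}{s+2}}$$ from some $N$ on (i.e. for all $N\ge N_0$ and all sequences $x_n\in\mathbb R$, $y_n\in[-1,1]$, where $N_0$ does not depend on the $x_n$ and $y_n$). -/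

import Mathlib

namespace OnlineRegression

/-- A (deterministic) strategy for Predictor: it maps the list of past rounds
`(signal, observation)`, most recent round first, and the current signal to a prediction. -/
abbrev Strategy : Type := List (ℝ × ℝ) → ℝ → ℝ

/-- The rounds `0, …, n - 1` of the play with signals `x` and observations `y`,
most recent round first. -/
def history (x y : ℕ → ℝ) : ℕ → List (ℝ × ℝ)
  | 0 => []
  | n + 1 => (x n, y n) :: history x y n

/-- The prediction made by the strategy `S` in round `n` (rounds are numbered from `0`). -/
def prediction (S : Strategy) (x y : ℕ → ℝ) (n : ℕ) : ℝ :=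
  S (history x y n) (x n)

/-- The cumulative quadratic loss of the strategy `S` over the rounds in a given list. -/
def pastLoss (S : Strategy) : List (ℝ × ℝ) → ℝ
  | [] => 0
  | r :: past => (r.2 - S past r.1) ^ 2 + pastLoss S past

/-- The aggregating algorithm for observations in `[-1, 1]` (learning rate `1 / 8`): the
prediction is the mean of the predictions of the strategies `S i` with respect to the weights
`w i * exp (-(past loss of S i) / 8)`, normalised. -/
noncomputable def aaMixture {ι : Type} (w : ι → ℝ) (S : ι → Strategy) : Strategy :=
  fun past x =>
    (∑' i, w i * Real.exp (-(pastLoss (S i) past) / 8) * S i past x) /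
      ∑' i, w i * Real.exp (-(pastLoss (S i) past) / 8)

/-- The strategy that follows the prediction rule `G`, truncated to `[-1, 1]`. -/
noncomputable def clippedRule (G : ℝ → ℝ) : Strategy :=
  fun _ x => max (-1) (min 1 (G x))

/-- `f` is an analytic continuation of `F : ℝ → ℝ` to the closed strip `|Im z| ≤ h`. -/
def IsContinuation (h : ℝ) (F : ℝ → ℝ) (f : ℂ → ℂ) : Prop :=
  AnalyticOnNhd ℂ f {z : ℂ | |z.im| ≤ h} ∧ ∀ x : ℝ, f (x : ℂ) = (F x : ℂ)

/-- The closed ball of radius `r` centred at `0` in the space `A_h` of the `2π`-periodic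
functions `ℝ → ℝ` that can be analytically continued to `|Im z| ≤ h`, normed by the supremum
of the modulus of the (unique) continuation over that strip. -/
def ballA (h r : ℝ) : Set (ℝ → ℝ) :=
  {F | Function.Periodic F (2 * Real.pi) ∧
    ∃ f : ℂ → ℂ, IsContinuation h F f ∧ ∀ z : ℂ, |z.im| ≤ h → ‖f z‖ ≤ r}

/-- `T` is a finite `ε`-net, in the uniform distance, for the set `A`, with elements in `A`. -/
def IsNet (ε : ℝ) (A : Set (ℝ → ℝ)) (T : Finset (ℝ → ℝ)) : Prop :=
  (∀ G ∈ T, G ∈ A) ∧ ∀ F ∈ A, ∃ G ∈ T, ∀ x : ℝ, |F x - G x| ≤ ε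

/-- An `ε`-net for `A` with the minimum number of elements. -/
def IsMinimalNet (ε : ℝ) (A : Set (ℝ → ℝ)) (T : Finset (ℝ → ℝ)) : Prop :=
  IsNet ε A T ∧ ∀ T' : Finset (ℝ → ℝ), IsNet ε A T' → T.card ≤ T'.card

/-- `net i j` is a minimal `2 ^ (-(j + 1))`-net for `2 ^ (i + 1)` times the unit ball
of `A_h`. -/
def IsNetSystem (h : ℝ) (net : ℕ → ℕ → Finset (ℝ → ℝ)) : Prop :=
  ∀ i j : ℕ, IsMinimalNet ((1 / 2 : ℝ) ^ (j + 1)) (ballA h (2 ^ (i + 1))) (net i j)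

/-- The weights `(6 / π²) (i + 1)⁻²`, `i = 0, 1, …`, which sum to `1`. -/
noncomputable def baselWeight (i : ℕ) : ℝ :=
  6 / Real.pi ^ 2 * (((i : ℝ) + 1) ^ 2)⁻¹

/-- The strategy for a compact class given by nets `T 0, T 1, …`: the AA mixture of all
(truncated) elements of all nets, each element of `T j` having weight
`(6 / π²) (j + 1)⁻² / |T j|`. -/
noncomputable def compactStrategy (T : ℕ → Finset (ℝ → ℝ)) : Strategy :=
  aaMixture (ι := Σ j : ℕ, {G : ℝ → ℝ // G ∈ T j})
    (fun p => baselWeight p.1 / ((T p.1).card : ℝ))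
    (fun p => clippedRule p.2.1)

/-- The strategy for a Banach class: the AA mixture, with weights `(6 / π²) (i + 1)⁻²`, of the
strategies for the compact classes `2 ^ (i + 1)` times the unit ball. -/
noncomputable def banachStrategy (net : ℕ → ℕ → Finset (ℝ → ℝ)) : Strategy :=
  aaMixture baselWeight (fun i => compactStrategy (net i))

end OnlineRegression

namespace OnlineRegression
open Real Set Filter Topology

/-! ### Regret of the aggregating algorithm -/

/-! The regret against F is an approximation error plus the cost of finding the approximant.

Cost: since exp(-u²/8) is concave on [-2, 2], an AA mixture loses at most 8 log(1/w) more than a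
component of weight w (`pastLoss_aaMixture_le`). Applied at both levels, this bounds the regret
against an element of `net i j` by 8(2 + 2i + 2j + log |net i j|). Fourier coefficients of functions
in A_h decay like exp(-h|k|), so rounding about p/h of them to O(p) bits, where p = i + j + 2,
bounds the log-cardinality by 20p²/h for large p (`log_card_isMinimalNet_le`).

Approximation: by Jackson's theorem (`exists_trigPoly_of_iteratedDeriv_holder`) F is within
c·52^(k+1)·m^(-s) of a trigonometric polynomial P of degree m. By Phragmén–Lindelöf, |P| ≤ D·exp(mh)
on the strip if |P| ≤ D on the line (`mem_ballA_of_mem_trigPoly`). So i of order mh and j of order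
log N suffice to replace P by a net element at total extra loss O(1), and the cost is O(hm²) once
log N and log D are below hm.

Balancing N·c·q^(-s) against h·q² gives q = (Nc/h)^(1/(s+2)), and h·q² is the claimed rate. Taking m
= ⌈52q⌉ cancels the factor 52^k in Jackson's bound, so the final constant is independent of k.
Everything else depending on h, c or F is absorbed by taking N large. -/

theorem hasDerivAt_exp_neg_sq_div_eight (u : ℝ) :
    HasDerivAt (fun u : ℝ => exp (-u ^ 2 / 8)) (-u / 4 * exp (-u ^ 2 / 8)) u := by
  have h : HasDerivAt (fun u : ℝ => -u ^ 2 / 8) (-u / 4) u := by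
    refine (((hasDerivAt_pow 2 u).neg).div_const 8).congr_deriv ?_
    norm_num; ring
  exact h.exp.congr_deriv (by ring)

/-- The second derivative has the sign of u² - 4. The interval [-2, 2] contains all differences
between an observation and a prediction in [-1, 1], which is why the learning rate 1/8 works. -/
theorem concaveOn_exp_neg_sq_div_eight :
    ConcaveOn ℝ (Icc (-2) 2) (fun u : ℝ => exp (-u ^ 2 / 8)) := by
  have hd : deriv (fun u : ℝ => exp (-u ^ 2 / 8)) = fun u => -u / 4 * exp (-u ^ 2 / 8) :=
    funext fun u => (hasDerivAt_exp_neg_sq_div_eight u).deriv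
  have hd2 : ∀ u : ℝ, HasDerivAt (fun u : ℝ => -u / 4 * exp (-u ^ 2 / 8))
      ((u ^ 2 - 4) / 16 * exp (-u ^ 2 / 8)) u := by
    intro u
    have h1 : HasDerivAt (fun u : ℝ => -u / 4) (-1 / 4) u := ((hasDerivAt_id u).neg).div_const 4
    exact (h1.mul (hasDerivAt_exp_neg_sq_div_eight u)).congr_deriv (by ring)
  refine concaveOn_of_deriv2_nonpos (convex_Icc _ _) (by fun_prop) ?_ ?_ ?_
  · exact fun u _ => (hasDerivAt_exp_neg_sq_div_eight u).differentiableAt.differentiableWithinAt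
  · rw [hd]
    exact fun u _ => (hd2 u).differentiableAt.differentiableWithinAt
  · intro u hu
    replace hu := interior_subset hu
    simp only [Function.iterate_succ, Function.iterate_zero, Function.comp, id, hd,
      (hd2 u).deriv]
    have : u ^ 2 ≤ 4 := by
      obtain ⟨h1, h2⟩ := hu
      nlinarith
    exact mul_nonpos_of_nonpos_of_nonneg (by linarith) (exp_pos _).le

/-- The tangent form of concavity: averaged over the strategies with v the residual of their
weighted mean, the linear term vanishes. It replaces Jensen's inequality for infinite mixtures. -/
theorem exp_neg_sq_le_tangent {u v : ℝ} (hu : u ∈ Icc (-2 : ℝ) 2) (hv : v ∈ Icc (-2 : ℝ) 2) :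
    exp (-u ^ 2 / 8) ≤ exp (-v ^ 2 / 8) * (1 - v / 4 * (u - v)) := by
  have hd := hasDerivAt_exp_neg_sq_div_eight v
  rcases lt_trichotomy u v with h | h | h
  · have := concaveOn_exp_neg_sq_div_eight.le_slope_of_hasDerivAt hu hv h hd
    rw [slope_def_field, le_div_iff₀ (sub_pos.2 h)] at this
    nlinarith
  · subst h; simp
  · have := concaveOn_exp_neg_sq_div_eight.slope_le_of_hasDerivAt hv hu h hd
    rw [slope_def_field, div_le_iff₀ (sub_pos.2 h)] at this
    nlinarith

section Mixture

variable {ι : Type} {w : ι → ℝ} {S : ι → Strategy}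

theorem pastLoss_nonneg (S : Strategy) (past : List (ℝ × ℝ)) : 0 ≤ pastLoss S past := by
  induction past with
  | nil => exact le_rfl
  | cons r past ih => exact add_nonneg (sq_nonneg _) ih

theorem summable_weight_mul_exp (hw : ∀ i, 0 ≤ w i) (hs : Summable w) (past : List (ℝ × ℝ)) :
    Summable fun i => w i * exp (-(pastLoss (S i) past) / 8) := by
  refine Summable.of_nonneg_of_le (fun i => mul_nonneg (hw i) (exp_pos _).le) (fun i => ?_) hs
  refine mul_le_of_le_one_right (hw i) (exp_le_one_iff.2 ?_)
  have := pastLoss_nonneg (S i) past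
  linarith

theorem summable_mul_of_abs_le_one {a b : ι → ℝ} (ha : ∀ i, 0 ≤ a i) (hs : Summable a)
    (hb : ∀ i, |b i| ≤ 1) : Summable fun i => a i * b i := by
  refine Summable.of_norm_bounded hs fun i => ?_
  rw [norm_mul, norm_of_nonneg (ha i)]
  exact mul_le_of_le_one_right (ha i) (hb i)

theorem abs_aaMixture_le_one (hw : ∀ i, 0 ≤ w i) (hs : Summable w)
    (hS : ∀ i past x, |S i past x| ≤ 1) (past : List (ℝ × ℝ)) (x : ℝ) :
    |aaMixture w S past x| ≤ 1 := by
  have ha : ∀ i, 0 ≤ w i * exp (-(pastLoss (S i) past) / 8) :=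
    fun i => mul_nonneg (hw i) (exp_pos _).le
  have hsa := summable_weight_mul_exp (S := S) hw hs past
  have hsb := summable_mul_of_abs_le_one ha hsa (fun i => hS i past x)
  rw [aaMixture, abs_div, abs_of_nonneg (tsum_nonneg ha)]
  refine div_le_one_of_le₀ ?_ (tsum_nonneg ha)
  rw [← norm_eq_abs]
  refine tsum_of_norm_bounded hsa.hasSum fun i => ?_
  rw [norm_mul, norm_of_nonneg (ha i)]
  exact mul_le_of_le_one_right (ha i) (hS i past x)

/-- The exponential-weights potential is dominated by the exponentiated loss of the mixture. -/
theorem tsum_weight_mul_exp_le (hw : ∀ i, 0 ≤ w i) (hs : Summable w) (h1 : ∑' i, w i ≤ 1)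
    (hS : ∀ i past x, |S i past x| ≤ 1) (past : List (ℝ × ℝ)) (hy : ∀ r ∈ past, |r.2| ≤ 1) :
    ∑' i, w i * exp (-(pastLoss (S i) past) / 8) ≤
      exp (-(pastLoss (aaMixture w S) past) / 8) := by
  induction past with
  | nil => simpa [pastLoss] using h1
  | cons r past ih =>
    have ih := ih fun q hq => hy q (List.mem_cons_of_mem _ hq)
    have hr : |r.2| ≤ 1 := hy r List.mem_cons_self
    set a : ι → ℝ := fun i => w i * exp (-(pastLoss (S i) past) / 8) with ha_def
    set m := aaMixture w S past r.1 with hm_def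
    have ha : ∀ i, 0 ≤ a i := fun i => mul_nonneg (hw i) (exp_pos _).le
    have hsa : Summable a := summable_weight_mul_exp (S := S) hw hs past
    have hsb := summable_mul_of_abs_le_one ha hsa (fun i => hS i past r.1)
    have hm : |m| ≤ 1 := abs_aaMixture_le_one hw hs hS past r.1
    have hmean : ∑' i, a i * S i past r.1 = m * ∑' i, a i := by
      rcases (tsum_nonneg ha).eq_or_lt with h0 | h0
      -- With zero total weight the prediction is 0/0 = 0, but then every weight vanishes.
      · have : ∀ i, a i = 0 := fun i =>
          congrFun ((hasSum_zero_iff_of_nonneg ha).1 (h0 ▸ hsa.hasSum)) i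
        simp [this]
      · rw [hm_def, aaMixture, div_mul_cancel₀ _ h0.ne']
    set e := exp (-(r.2 - m) ^ 2 / 8) with he
    set κ := (r.2 - m) / 4
    -- The tangent bound at r.2 - m, written as an affine function of the prediction of `S i` so
    -- that it can be summed using `hmean`.
    have hstep : ∀ i, w i * exp (-(pastLoss (S i) (r :: past)) / 8) ≤
        e * ((1 - κ * m) * a i + κ * (a i * S i past r.1)) := by
      intro i
      have hSi := hS i past r.1
      rw [abs_le] at hSi hr hm
      have ht := exp_neg_sq_le_tangent (u := r.2 - S i past r.1) (v := r.2 - m)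
        ⟨by linarith, by linarith⟩ ⟨by linarith, by linarith⟩
      have : w i * exp (-(pastLoss (S i) (r :: past)) / 8) =
          a i * exp (-(r.2 - S i past r.1) ^ 2 / 8) := by
        rw [ha_def, mul_assoc, ← exp_add]
        congr 2
        simp only [pastLoss]
        ring
      rw [this]
      refine (mul_le_mul_of_nonneg_left ht (ha i)).trans (le_of_eq ?_)
      simp only [he, κ]
      ring
    have hsr : Summable fun i => e * ((1 - κ * m) * a i + κ * (a i * S i past r.1)) :=
      ((hsa.mul_left _).add (hsb.mul_left _)).mul_left _
    calc _ ≤ ∑' i, e * ((1 - κ * m) * a i + κ * (a i * S i past r.1)) :=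
          (summable_weight_mul_exp (S := S) hw hs (r :: past)).tsum_le_tsum hstep hsr
      _ = e * ∑' i, a i := by
          rw [tsum_mul_left, (hsa.mul_left _).tsum_add (hsb.mul_left _), tsum_mul_left,
            tsum_mul_left, hmean]
          ring
      _ ≤ e * exp (-(pastLoss (aaMixture w S) past) / 8) := by gcongr
      _ = _ := by
          rw [he, ← exp_add]
          congr 1
          simp only [pastLoss]
          ring

/-- The regret bound of the aggregating algorithm. -/
theorem pastLoss_aaMixture_le (hw : ∀ i, 0 ≤ w i) (hs : Summable w) (h1 : ∑' i, w i ≤ 1)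
    (hS : ∀ i past x, |S i past x| ≤ 1) {past : List (ℝ × ℝ)} (hy : ∀ r ∈ past, |r.2| ≤ 1)
    {i : ι} (hi : 0 < w i) :
    pastLoss (aaMixture w S) past ≤ pastLoss (S i) past + 8 * log (w i)⁻¹ := by
  have h := tsum_weight_mul_exp_le hw hs h1 hS past hy
  have h2 : w i * exp (-(pastLoss (S i) past) / 8) ≤ exp (-(pastLoss (aaMixture w S) past) / 8) :=
    ((summable_weight_mul_exp (S := S) hw hs past).le_tsum i
      fun j _ => mul_nonneg (hw j) (exp_pos _).le).trans h
  have h3 := log_le_log (by positivity) h2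
  rw [log_mul hi.ne' (exp_pos _).ne', log_exp, log_exp] at h3
  rw [log_inv]
  linarith

end Mixture

/-! ### Regret of the two-level mixture over nets -/

theorem hasSum_baselWeight : HasSum baselWeight 1 := by
  have h := (hasSum_nat_add_iff' (f := fun n : ℕ => (1 : ℝ) / (n : ℝ) ^ 2) 1).2 hasSum_zeta_two
  have h2 := h.mul_left (6 / π ^ 2)
  have e : 6 / π ^ 2 * (π ^ 2 / 6 - ∑ i ∈ Finset.range 1, (1 : ℝ) / (i : ℝ) ^ 2) = 1 := by
    simp
  rw [e] at h2
  refine h2.congr_fun fun i => ?_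
  simp [baselWeight]

theorem baselWeight_pos (i : ℕ) : 0 < baselWeight i := by
  unfold baselWeight; positivity

/-- A crude linear bound is enough, because the entropy term is quadratic in the indices. -/
theorem log_inv_baselWeight_le (i : ℕ) : log (baselWeight i)⁻¹ ≤ 1 + 2 * i := by
  have hpi : π ^ 2 / 6 ≤ 2 := by nlinarith [pi_lt_d2, pi_pos]
  have : (baselWeight i)⁻¹ = π ^ 2 / 6 * ((i : ℝ) + 1) ^ 2 := by
    unfold baselWeight; field_simp
  rw [this, log_mul (by positivity) (by positivity), log_pow]
  have h1 := log_le_sub_one_of_pos (x := π ^ 2 / 6) (by positivity)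
  have h2 := log_le_sub_one_of_pos (x := (i : ℝ) + 1) (by positivity)
  push_cast
  linarith

theorem abs_clippedRule_le_one (G : ℝ → ℝ) (past : List (ℝ × ℝ)) (x : ℝ) :
    |clippedRule G past x| ≤ 1 := by
  rw [clippedRule, abs_le]
  exact ⟨le_max_left _ _, max_le (by norm_num) (min_le_left _ _)⟩

section Compact

variable (T : ℕ → Finset (ℝ → ℝ))

/-- An empty net forfeits its share of the mass, so for arbitrary `T` the total weight is only at
most 1, which is all the regret bound needs. -/
theorem hasSum_compactWeight_fiber (j : ℕ) :
    HasSum (fun _ : {G : ℝ → ℝ // G ∈ T j} => baselWeight j / ((T j).card : ℝ))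
      (if (T j).Nonempty then baselWeight j else 0) := by
  have := hasSum_fintype (fun _ : {G : ℝ → ℝ // G ∈ T j} => baselWeight j / ((T j).card : ℝ))
  convert this using 1
  rw [Finset.sum_const, Finset.card_univ, Fintype.card_coe, nsmul_eq_mul]
  split_ifs with h
  · have : ((T j).card : ℝ) ≠ 0 := by exact_mod_cast h.card_pos.ne'
    field_simp
  · rw [Finset.not_nonempty_iff_eq_empty] at h
    simp [h]

theorem compactWeight_nonneg (p : Σ j : ℕ, {G : ℝ → ℝ // G ∈ T j}) :
    0 ≤ baselWeight p.1 / ((T p.1).card : ℝ) :=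
  div_nonneg (baselWeight_pos _).le (Nat.cast_nonneg _)

theorem summable_compactWeight :
    Summable fun p : Σ j : ℕ, {G : ℝ → ℝ // G ∈ T j} => baselWeight p.1 / ((T p.1).card : ℝ) := by
  refine (summable_sigma_of_nonneg (compactWeight_nonneg T)).2
    ⟨fun j => (hasSum_compactWeight_fiber T j).summable, ?_⟩
  refine Summable.of_nonneg_of_le (fun j => tsum_nonneg fun G => compactWeight_nonneg T ⟨j, G⟩)
    (fun j => ?_) hasSum_baselWeight.summable
  rw [(hasSum_compactWeight_fiber T j).tsum_eq]
  split_ifs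
  exacts [le_rfl, (baselWeight_pos j).le]

theorem tsum_compactWeight_le_one :
    ∑' p : Σ j : ℕ, {G : ℝ → ℝ // G ∈ T j}, baselWeight p.1 / ((T p.1).card : ℝ) ≤ 1 := by
  have hs := summable_compactWeight T
  rw [hs.tsum_sigma, ← hasSum_baselWeight.tsum_eq]
  refine hs.sigma.tsum_le_tsum (fun j => ?_) hasSum_baselWeight.summable
  rw [(hasSum_compactWeight_fiber T j).tsum_eq]
  split_ifs
  exacts [le_rfl, (baselWeight_pos j).le]

theorem abs_compactStrategy_le_one (past : List (ℝ × ℝ)) (x : ℝ) :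
    |compactStrategy T past x| ≤ 1 :=
  abs_aaMixture_le_one (compactWeight_nonneg T) (summable_compactWeight T)
    (fun _ => abs_clippedRule_le_one _) past x

theorem pastLoss_compactStrategy_le {past : List (ℝ × ℝ)} (hy : ∀ r ∈ past, |r.2| ≤ 1)
    {j : ℕ} {G : ℝ → ℝ} (hG : G ∈ T j) :
    pastLoss (compactStrategy T) past ≤
      pastLoss (clippedRule G) past + 8 * (1 + 2 * j + log (T j).card) := by
  have hc : 0 < ((T j).card : ℝ) := by exact_mod_cast Finset.card_pos.2 ⟨G, hG⟩
  have h := pastLoss_aaMixture_le (compactWeight_nonneg T) (summable_compactWeight T)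
    (tsum_compactWeight_le_one T) (S := fun p => clippedRule p.2.1)
    (fun _ => abs_clippedRule_le_one _) hy (i := ⟨j, G, hG⟩) (div_pos (baselWeight_pos j) hc)
  have h2 : log (baselWeight j / ((T j).card : ℝ))⁻¹ ≤ 1 + 2 * j + log (T j).card := by
    rw [inv_div, div_eq_mul_inv, log_mul hc.ne' (inv_pos.2 (baselWeight_pos j)).ne']
    linarith [log_inv_baselWeight_le j]
  unfold compactStrategy
  linarith

end Compact

theorem pastLoss_banachStrategy_le (net : ℕ → ℕ → Finset (ℝ → ℝ)) {past : List (ℝ × ℝ)}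
    (hy : ∀ r ∈ past, |r.2| ≤ 1) {i j : ℕ} {G : ℝ → ℝ} (hG : G ∈ net i j) :
    pastLoss (banachStrategy net) past ≤
      pastLoss (clippedRule G) past + 8 * (2 + 2 * i + 2 * j + log (net i j).card) := by
  have h := pastLoss_aaMixture_le (fun i => (baselWeight_pos i).le) hasSum_baselWeight.summable
    hasSum_baselWeight.tsum_eq.le (S := fun i => compactStrategy (net i))
    (fun i => abs_compactStrategy_le_one (net i)) hy (baselWeight_pos i)
  have h2 := pastLoss_compactStrategy_le (net i) hy hG
  have h3 := log_inv_baselWeight_le i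
  unfold banachStrategy
  linarith

theorem pastLoss_history (S : Strategy) (x y : ℕ → ℝ) (N : ℕ) :
    pastLoss S (history x y N) = ∑ n ∈ Finset.range N, (y n - prediction S x y n) ^ 2 := by
  induction N with
  | zero => rfl
  | succ N ih =>
    rw [Finset.sum_range_succ, ← ih, history, pastLoss, add_comm]
    rfl

theorem abs_le_one_of_mem_history {x y : ℕ → ℝ} (hy : ∀ n, |y n| ≤ 1) (N : ℕ) :
    ∀ r ∈ history x y N, |r.2| ≤ 1 := by
  induction N with
  | zero => simp [history]
  | succ N ih =>
    intro r hr
    rcases List.mem_cons.1 hr with rfl | hr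
    exacts [hy N, ih r hr]

/-- Truncating to [-1, 1] is 1-Lipschitz and moves a prediction no farther from y. Between truncated
predictions, the difference of squares has a second factor of modulus at most 4. -/
theorem sq_sub_clip_le {y a b δ : ℝ} (hy : |y| ≤ 1) (hab : |a - b| ≤ δ) :
    (y - max (-1) (min 1 b)) ^ 2 ≤ (y - a) ^ 2 + 4 * δ := by
  set A := max (-1) (min 1 a) with hA
  set B := max (-1) (min 1 b) with hB
  have hA1 : |A| ≤ 1 := abs_clippedRule_le_one (fun _ => a) [] 0
  have hB1 : |B| ≤ 1 := abs_clippedRule_le_one (fun _ => b) [] 0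
  have hAB : |A - B| ≤ δ := by
    refine (abs_max_sub_max_le_max _ _ _ _).trans ?_
    rw [sub_self, abs_zero, max_eq_right (abs_nonneg _)]
    refine (abs_min_sub_min_le_max _ _ _ _).trans ?_
    rwa [sub_self, abs_zero, max_eq_right (abs_nonneg _)]
  have hyA : (y - A) ^ 2 ≤ (y - a) ^ 2 := by
    rw [abs_le] at hy
    rcases le_total a (-1) with h | h
    · have : A = -1 := by rw [hA, min_eq_right (by linarith), max_eq_left h]
      rw [this]; nlinarith
    · rcases le_total a 1 with h' | h'
      · have : A = a := by rw [hA, min_eq_right h', max_eq_right h]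
        rw [this]
      · have : A = 1 := by rw [hA, min_eq_left h', max_eq_right (by norm_num)]
        rw [this]; nlinarith
  have : (y - B) ^ 2 - (y - A) ^ 2 ≤ 4 * δ := by
    calc (y - B) ^ 2 - (y - A) ^ 2 = (A - B) * (2 * y - A - B) := by ring
      _ ≤ |A - B| * |2 * y - A - B| := by rw [← abs_mul]; exact le_abs_self _
      _ ≤ δ * 4 := by
        gcongr
        · exact (abs_nonneg _).trans hAB
        · rw [abs_le] at *
          constructor <;> linarith
      _ = 4 * δ := by ring
  linarith

/-- The loss of the strategy for a Banach class against a rule that is uniformly close to an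
element of one of the nets. -/
theorem sum_sq_banachStrategy_le (net : ℕ → ℕ → Finset (ℝ → ℝ)) {i j : ℕ} {F G : ℝ → ℝ}
    (hG : G ∈ net i j) {δ : ℝ} (hFG : ∀ x, |F x - G x| ≤ δ) (N : ℕ) {x y : ℕ → ℝ}
    (hy : ∀ n, |y n| ≤ 1) :
    ∑ n ∈ Finset.range N, (y n - prediction (banachStrategy net) x y n) ^ 2 ≤
      ∑ n ∈ Finset.range N, (y n - F (x n)) ^ 2 +
        (4 * N * δ + 8 * (2 + 2 * i + 2 * j + log (net i j).card)) := by
  have h := pastLoss_banachStrategy_le net (abs_le_one_of_mem_history (x := x) hy N) hG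
  rw [pastLoss_history, pastLoss_history] at h
  have h2 : ∑ n ∈ Finset.range N, (y n - prediction (clippedRule G) x y n) ^ 2 ≤
      ∑ n ∈ Finset.range N, ((y n - F (x n)) ^ 2 + 4 * δ) :=
    Finset.sum_le_sum fun n _ => sq_sub_clip_le (hy n) (hFG (x n))
  rw [Finset.sum_add_distrib, Finset.sum_const, Finset.card_range, nsmul_eq_mul] at h2
  linarith

/-! ### Jackson's theorem for trigonometric polynomials -/

/-- The real trigonometric polynomials of degree at most `m`. -/
def trigPoly (m : ℕ) : Submodule ℝ (ℝ → ℝ) :=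
  Submodule.span ℝ
    {f | ∃ k : ℕ, k ≤ m ∧ (f = (fun x => cos (k * x)) ∨ f = fun x => sin (k * x))}

theorem cos_mem_trigPoly {m k : ℕ} (hk : k ≤ m) : (fun x : ℝ => cos (k * x)) ∈ trigPoly m :=
  Submodule.subset_span ⟨k, hk, Or.inl rfl⟩

theorem sin_mem_trigPoly {m k : ℕ} (hk : k ≤ m) : (fun x : ℝ => sin (k * x)) ∈ trigPoly m :=
  Submodule.subset_span ⟨k, hk, Or.inr rfl⟩

theorem cos_int_mem_trigPoly {m : ℕ} {k : ℤ} (hk : k.natAbs ≤ m) :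
    (fun x : ℝ => cos (k * x)) ∈ trigPoly m := by
  have := cos_mem_trigPoly hk
  rcases Int.natAbs_eq k with h | h <;> rw [h] <;> simpa using this

theorem sin_int_mem_trigPoly {m : ℕ} {k : ℤ} (hk : k.natAbs ≤ m) :
    (fun x : ℝ => sin (k * x)) ∈ trigPoly m := by
  have := sin_mem_trigPoly hk
  rcases Int.natAbs_eq k with h | h <;> rw [h]
  · simpa using this
  · have h2 := (trigPoly m).neg_mem this
    convert h2 using 1
    ext x
    simp

theorem periodic_of_mem_trigPoly {m : ℕ} {P : ℝ → ℝ} (hP : P ∈ trigPoly m) :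
    Function.Periodic P (2 * π) := by
  induction hP using Submodule.span_induction with
  | mem f hf =>
    obtain ⟨k, -, rfl | rfl⟩ := hf <;> intro x <;> simp only [mul_add]
    · exact cos_add_nat_mul_two_pi _ k
    · exact sin_add_nat_mul_two_pi _ k
  | zero => intro x; rfl
  | add f g _ _ hf hg => exact hf.add hg
  | smul a f _ hf => exact hf.smul a

/-- A trigonometric polynomial has an antiderivative of the same kind up to its mean. -/
theorem exists_antideriv_trigPoly {m : ℕ} {P : ℝ → ℝ} (hP : P ∈ trigPoly m) :
    ∃ a : ℝ, ∃ Q ∈ trigPoly m, ∀ x, HasDerivAt Q (P x - a) x := by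
  induction hP using Submodule.span_induction with
  | mem f hf =>
    obtain ⟨k, hk, h⟩ := hf
    rcases Nat.eq_zero_or_pos k with rfl | hpos
    · refine ⟨f 0, 0, zero_mem _, fun x => ?_⟩
      have : f x - f 0 = 0 := by rcases h with rfl | rfl <;> simp
      rw [this]
      exact hasDerivAt_const x 0
    · have hk0 : (k : ℝ) ≠ 0 := by exact_mod_cast hpos.ne'
      have hl : ∀ x : ℝ, HasDerivAt (fun x : ℝ => k * x) k x := fun x => by
        simpa using (hasDerivAt_id x).const_mul (k : ℝ)
      rcases h with rfl | rfl
      · refine ⟨0, (k : ℝ)⁻¹ • fun x : ℝ => sin (k * x),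
          Submodule.smul_mem _ _ (sin_mem_trigPoly hk), fun x => ?_⟩
        refine ((hl x).sin.const_mul (k : ℝ)⁻¹).congr_deriv ?_
        field_simp
        simp
      · refine ⟨0, (-(k : ℝ)⁻¹) • fun x : ℝ => cos (k * x),
          Submodule.smul_mem _ _ (cos_mem_trigPoly hk), fun x => ?_⟩
        refine ((hl x).cos.const_mul (-(k : ℝ)⁻¹)).congr_deriv ?_
        field_simp
        simp
  | zero => exact ⟨0, 0, zero_mem _, fun x => by simp⟩
  | add f g _ _ hf hg =>
    obtain ⟨a, Q, hQ, hQd⟩ := hf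
    obtain ⟨b, R, hR, hRd⟩ := hg
    exact ⟨a + b, Q + R, add_mem hQ hR, fun x =>
      ((hQd x).add (hRd x)).congr_deriv (by simp only [Pi.add_apply]; ring)⟩
  | smul b f _ hf =>
    obtain ⟨a, Q, hQ, hQd⟩ := hf
    exact ⟨b * a, b • Q, Submodule.smul_mem _ _ hQ, fun x =>
      ((hQd x).const_mul b).congr_deriv (by simp only [Pi.smul_apply, smul_eq_mul]; ring)⟩

theorem integral_cos_int_mul (k : ℤ) :
    ∫ t in -π..π, cos (k * t) = if k = 0 then 2 * π else 0 := by
  split_ifs with h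
  · simp [h]; ring
  · have hk : (k : ℝ) ≠ 0 := by exact_mod_cast h
    rw [intervalIntegral.integral_comp_mul_left (fun t => cos t) hk, integral_cos]
    simp [sin_int_mul_pi]

/-- The coefficients of the square root of the Fejér–Korovkin kernel. -/
noncomputable def korovkinCoeff (n j : ℕ) : ℝ := sin (j * (π / n))

/-- The (unnormalised) Fejér–Korovkin kernel. -/
noncomputable def korovkinKernel (n : ℕ) (t : ℝ) : ℝ :=
  ∑ j ∈ Finset.range n, ∑ l ∈ Finset.range n,
    korovkinCoeff n j * korovkinCoeff n l * cos (((j : ℤ) - l : ℤ) * t)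

/-- The integral of the Fejér–Korovkin kernel over a period. -/
noncomputable def korovkinMass (n : ℕ) : ℝ :=
  2 * π * ∑ j ∈ Finset.range n, korovkinCoeff n j ^ 2

/-- The kernel is the squared modulus of Σ a_j exp(ijt), where a_j = `korovkinCoeff n j`. -/
theorem korovkinKernel_nonneg (n : ℕ) (t : ℝ) : 0 ≤ korovkinKernel n t := by
  have : korovkinKernel n t = (∑ j ∈ Finset.range n, korovkinCoeff n j * cos (j * t)) ^ 2 +
      (∑ j ∈ Finset.range n, korovkinCoeff n j * sin (j * t)) ^ 2 := by
    rw [sq, sq, Finset.sum_mul_sum, Finset.sum_mul_sum, ← Finset.sum_add_distrib, korovkinKernel]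
    refine Finset.sum_congr rfl fun j _ => ?_
    rw [← Finset.sum_add_distrib]
    refine Finset.sum_congr rfl fun l _ => ?_
    push_cast
    rw [sub_mul, cos_sub]
    ring
  rw [this]
  positivity

theorem continuous_korovkinKernel (n : ℕ) : Continuous (korovkinKernel n) := by
  unfold korovkinKernel
  fun_prop

theorem periodic_korovkinKernel (n : ℕ) : Function.Periodic (korovkinKernel n) (2 * π) := by
  intro t
  unfold korovkinKernel
  refine Finset.sum_congr rfl fun j _ => Finset.sum_congr rfl fun l _ => ?_
  rw [mul_add, cos_add_int_mul_two_pi]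

theorem korovkinMass_pos {n : ℕ} (hn : 2 ≤ n) : 0 < korovkinMass n := by
  have hn' : (2 : ℝ) ≤ n := by exact_mod_cast hn
  refine mul_pos (by positivity) (Finset.sum_pos' (fun j _ => sq_nonneg _)
    ⟨1, Finset.mem_range.2 (by omega), pow_pos (sin_pos_of_pos_of_lt_pi ?_ ?_) 2⟩)
  · positivity
  · rw [Nat.cast_one, one_mul, div_lt_iff₀ (by positivity)]
    nlinarith [pi_pos]

theorem integral_korovkinKernel (n : ℕ) :
    ∫ t in -π..π, korovkinKernel n t = korovkinMass n := by
  unfold korovkinKernel korovkinMass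
  rw [intervalIntegral.integral_finsetSum
    fun j _ => Continuous.intervalIntegrable (by fun_prop) _ _, Finset.mul_sum]
  refine Finset.sum_congr rfl fun j hj => ?_
  rw [intervalIntegral.integral_finsetSum
    fun j _ => Continuous.intervalIntegrable (by fun_prop) _ _]
  simp_rw [intervalIntegral.integral_const_mul, integral_cos_int_mul, sub_eq_zero, Nat.cast_inj,
    mul_ite, mul_zero]
  rw [Finset.sum_ite_eq, if_pos hj]
  ring

/-- Multiplying by cos t pairs a_j with its neighbours, and a_j = sin(jπ/n) satisfies a_{j+1} +
a_{j-1} = 2cos(π/n)·a_j. -/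
theorem integral_korovkinKernel_mul_cos {n : ℕ} (hn : 2 ≤ n) :
    ∫ t in -π..π, korovkinKernel n t * cos t = cos (π / n) * korovkinMass n := by
  have hn0 : (n : ℝ) ≠ 0 := by positivity
  have hexp : ∀ t, korovkinKernel n t * cos t = ∑ j ∈ Finset.range n, ∑ l ∈ Finset.range n,
      korovkinCoeff n j * korovkinCoeff n l * (1 / 2) *
        (cos (((j : ℤ) - l + 1 : ℤ) * t) + cos (((j : ℤ) - l - 1 : ℤ) * t)) := by
    intro t
    rw [korovkinKernel, Finset.sum_mul]
    refine Finset.sum_congr rfl fun j _ => ?_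
    rw [Finset.sum_mul]
    refine Finset.sum_congr rfl fun l _ => ?_
    push_cast
    rw [add_mul _ (1 : ℝ), sub_mul _ (1 : ℝ), one_mul, cos_add, cos_sub _ t]
    ring
  simp_rw [hexp]
  rw [intervalIntegral.integral_finsetSum
    fun j _ => Continuous.intervalIntegrable (by fun_prop) _ _, korovkinMass, Finset.mul_sum,
    Finset.mul_sum]
  refine Finset.sum_congr rfl fun j hj => ?_
  rw [intervalIntegral.integral_finsetSum
    fun j _ => Continuous.intervalIntegrable (by fun_prop) _ _]
  have hint : ∀ l : ℕ, ∫ t in -π..π, korovkinCoeff n j * korovkinCoeff n l * (1 / 2) *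
        (cos (((j : ℤ) - l + 1 : ℤ) * t) + cos (((j : ℤ) - l - 1 : ℤ) * t)) =
      π * korovkinCoeff n j * ((if l = j + 1 then korovkinCoeff n l else 0) +
        (if l + 1 = j then korovkinCoeff n l else 0)) := by
    intro l
    rw [intervalIntegral.integral_const_mul, intervalIntegral.integral_add
      (Continuous.intervalIntegrable (by fun_prop) _ _)
      (Continuous.intervalIntegrable (by fun_prop) _ _), integral_cos_int_mul,
      integral_cos_int_mul]
    have e1 : ((j : ℤ) - l + 1 = 0) ↔ l = j + 1 := by omega
    have e2 : ((j : ℤ) - l - 1 = 0) ↔ l + 1 = j := by omega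
    simp only [e1, e2]
    split_ifs <;> ring
  simp_rw [hint]
  rw [← Finset.mul_sum, Finset.sum_add_distrib, Finset.sum_ite_eq']
  -- The recurrence survives at both ends: a_n = sin π = 0, and for j = 0 the outer factor a_0 is
  -- zero.
  have h1 : (if j + 1 ∈ Finset.range n then korovkinCoeff n (j + 1) else 0) =
      sin ((j + 1 : ℝ) * (π / n)) := by
    simp only [Finset.mem_range] at hj ⊢
    split_ifs with h
    · simp [korovkinCoeff]
    · have : (j : ℝ) + 1 = n := by
        have : j + 1 = n := by omega
        exact_mod_cast this
      rw [this, mul_div_cancel₀ _ hn0, sin_pi]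
  have h2 : korovkinCoeff n j * ∑ l ∈ Finset.range n,
      (if l + 1 = j then korovkinCoeff n l else 0) =
      korovkinCoeff n j * sin ((j - 1 : ℝ) * (π / n)) := by
    rcases j with _ | j
    · simp [korovkinCoeff]
    · rw [Finset.mem_range] at hj
      simp only [add_left_inj]
      rw [Finset.sum_ite_eq', if_pos (Finset.mem_range.2 (by omega))]
      simp [korovkinCoeff]
  rw [h1, mul_assoc, mul_add (korovkinCoeff n j), h2, add_mul, sub_mul, one_mul, sin_add, sin_sub,
    korovkinCoeff]
  ring

/-- On [-π, π] one has t² ≤ (π²/2)(1 - cos t), which reduces the second moment to 1 - cos(π/n) ≤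
(π/n)²/2; the constant 25 bounds π⁴/4. -/
theorem integral_sq_mul_korovkinKernel_le {n : ℕ} (hn : 2 ≤ n) :
    ∫ t in -π..π, t ^ 2 * korovkinKernel n t ≤ 25 / n ^ 2 * korovkinMass n := by
  have hK := continuous_korovkinKernel n
  have hpi := pi_pos
  have hn0 : 0 < (n : ℝ) := by positivity
  have hmass := korovkinMass_pos hn
  calc ∫ t in -π..π, t ^ 2 * korovkinKernel n t
      ≤ ∫ t in -π..π, π ^ 2 / 2 * (korovkinKernel n t - korovkinKernel n t * cos t) := by
        refine intervalIntegral.integral_mono_on (by linarith)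
          (Continuous.intervalIntegrable (by fun_prop) _ _)
          (Continuous.intervalIntegrable (by fun_prop) _ _) fun t ht => ?_
        have h1 := cos_le_one_sub_mul_cos_sq (x := t) (abs_le.2 ⟨ht.1, ht.2⟩)
        have h2 : t ^ 2 ≤ π ^ 2 / 2 * (1 - cos t) := by
          have : π ^ 2 / 2 * (2 / π ^ 2 * t ^ 2) = t ^ 2 := by field_simp
          nlinarith [mul_le_mul_of_nonneg_left h1 (by positivity : 0 ≤ π ^ 2 / 2)]
        nlinarith [mul_le_mul_of_nonneg_right h2 (korovkinKernel_nonneg n t)]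
    _ = π ^ 2 / 2 * ((1 - cos (π / n)) * korovkinMass n) := by
        rw [intervalIntegral.integral_const_mul, intervalIntegral.integral_sub
          (Continuous.intervalIntegrable (by fun_prop) _ _)
          (Continuous.intervalIntegrable (by fun_prop) _ _), integral_korovkinKernel,
          integral_korovkinKernel_mul_cos hn]
        ring
    _ ≤ π ^ 2 / 2 * ((π / n) ^ 2 / 2 * korovkinMass n) := by
        have := one_sub_sq_div_two_le_cos (x := π / n)
        gcongr
        linarith
    _ = π ^ 4 / 4 / n ^ 2 * korovkinMass n := by ring
    _ ≤ 25 / n ^ 2 * korovkinMass n := by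
        gcongr
        have h1 : π ^ 2 ≤ 10 := by nlinarith [pi_lt_d2]
        nlinarith [sq_nonneg π]

/-- Convolution with the Fejér–Korovkin kernel yields a trigonometric polynomial. -/
theorem korovkin_convolution_mem_trigPoly (n : ℕ) {g : ℝ → ℝ} (hg : Continuous g) :
    (fun x => ∫ t in -π..π, g t * korovkinKernel n (x - t)) ∈ trigPoly n := by
  have : (fun x => ∫ t in -π..π, g t * korovkinKernel n (x - t)) =
      ∑ j ∈ Finset.range n, ∑ l ∈ Finset.range n, (korovkinCoeff n j * korovkinCoeff n l) •
        ((∫ t in -π..π, g t * cos (((j : ℤ) - l : ℤ) * t)) •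
            (fun x : ℝ => cos (((j : ℤ) - l : ℤ) * x)) +
          (∫ t in -π..π, g t * sin (((j : ℤ) - l : ℤ) * t)) •
            (fun x : ℝ => sin (((j : ℤ) - l : ℤ) * x))) := by
    ext x
    simp only [korovkinKernel, Finset.mul_sum, Finset.sum_apply, Pi.smul_apply, Pi.add_apply,
      smul_eq_mul]
    rw [intervalIntegral.integral_finsetSum
      fun j _ => Continuous.intervalIntegrable (by fun_prop) _ _]
    refine Finset.sum_congr rfl fun j _ => ?_
    rw [intervalIntegral.integral_finsetSum
      fun j _ => Continuous.intervalIntegrable (by fun_prop) _ _]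
    refine Finset.sum_congr rfl fun l _ => ?_
    rw [← intervalIntegral.integral_mul_const, ← intervalIntegral.integral_mul_const,
      ← intervalIntegral.integral_add (Continuous.intervalIntegrable (by fun_prop) _ _)
      (Continuous.intervalIntegrable (by fun_prop) _ _), ← intervalIntegral.integral_const_mul]
    refine intervalIntegral.integral_congr fun t _ => ?_
    simp only [mul_sub, cos_sub]
    ring
  rw [this]
  refine Submodule.sum_mem _ fun j hj => Submodule.sum_mem _ fun l hl => ?_
  rw [Finset.mem_range] at hj hl
  exact Submodule.smul_mem _ _ (Submodule.add_mem _
    (Submodule.smul_mem _ _ (cos_int_mem_trigPoly (by omega)))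
    (Submodule.smul_mem _ _ (sin_int_mem_trigPoly (by omega))))

theorem continuous_of_holder {g : ℝ → ℝ} {α c : ℝ} (hα : 0 < α)
    (hg : ∀ u v, |g u - g v| ≤ c * |u - v| ^ α) : Continuous g := by
  refine continuous_iff_continuousAt.2 fun v => ?_
  rw [ContinuousAt, tendsto_iff_dist_tendsto_zero]
  refine squeeze_zero (fun _ => dist_nonneg) (fun u => hg u v) ?_
  have : Continuous fun u : ℝ => c * |u - v| ^ α :=
    continuous_const.mul ((continuous_abs.comp (continuous_id.sub continuous_const)).rpow_const
      fun _ => Or.inr hα.le)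
  simpa [zero_rpow hα.ne'] using this.tendsto v

/-- Jackson's theorem for Hölder continuous functions. -/
theorem exists_trigPoly_of_holder {n : ℕ} (hn : 2 ≤ n) {g : ℝ → ℝ}
    (hper : Function.Periodic g (2 * π)) {α c : ℝ} (hα : 0 < α) (hα1 : α ≤ 1) (hc : 0 ≤ c)
    (hg : ∀ u v, |g u - g v| ≤ c * |u - v| ^ α) :
    ∃ P ∈ trigPoly n, ∀ x, |g x - P x| ≤ 26 * c * (n : ℝ) ^ (-α) := by
  have hcont := continuous_of_holder hα hg
  have hK := continuous_korovkinKernel n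
  have hpi := pi_pos
  have hn0 : 0 < (n : ℝ) := by positivity
  have hmass := korovkinMass_pos hn
  refine ⟨(korovkinMass n)⁻¹ • fun x => ∫ t in -π..π, g t * korovkinKernel n (x - t),
    Submodule.smul_mem _ _ (korovkin_convolution_mem_trigPoly n hcont), fun x => ?_⟩
  have hconv : ∫ t in -π..π, g t * korovkinKernel n (x - t) =
      ∫ t in -π..π, g (x - t) * korovkinKernel n t := by
    have hp : Function.Periodic (fun t => g (x - t) * korovkinKernel n t) (2 * π) := by
      intro t
      simp only
      rw [periodic_korovkinKernel n t, ← sub_sub, hper.sub_eq]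
    have h1 := intervalIntegral.integral_comp_sub_left
      (fun t => g (x - t) * korovkinKernel n t) (a := -π) (b := π) x
    simp only [sub_sub_cancel] at h1
    rw [h1]
    have h2 := hp.intervalIntegral_add_eq (x - π) (-π)
    rw [show x - π + 2 * π = x - -π by ring, show -π + 2 * π = π by ring] at h2
    exact h2
  -- Dominating |t|^α by a quadratic at scale 1/n means only the mass and the second moment matter;
  -- 26 = 1 + 25.
  have hpt : ∀ t, |t| ^ α ≤ (n : ℝ) ^ (-α) * (1 + n ^ 2 * t ^ 2) := by
    intro t
    have h1 : (n * |t|) ^ α ≤ 1 + n ^ 2 * t ^ 2 := by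
      have h0 : 0 ≤ n * |t| := by positivity
      have h2 : n ^ 2 * t ^ 2 = (n * |t|) ^ 2 := by rw [mul_pow, sq_abs]
      rw [h2]
      rcases le_total (n * |t|) 1 with h | h
      · nlinarith [rpow_le_one h0 h hα.le, sq_nonneg (n * |t|)]
      · have := rpow_le_rpow_of_exponent_le h hα1
        rw [rpow_one] at this
        nlinarith
    rw [mul_rpow hn0.le (abs_nonneg _)] at h1
    rw [rpow_neg hn0.le, inv_mul_eq_div, le_div_iff₀ (rpow_pos_of_pos hn0 _)]
    linarith
  have hdiff : g x - (korovkinMass n)⁻¹ * ∫ t in -π..π, g t * korovkinKernel n (x - t) =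
      (korovkinMass n)⁻¹ * ∫ t in -π..π, (g x - g (x - t)) * korovkinKernel n t := by
    simp_rw [hconv, sub_mul]
    rw [intervalIntegral.integral_sub (Continuous.intervalIntegrable (by fun_prop) _ _)
      (Continuous.intervalIntegrable (by fun_prop) _ _), intervalIntegral.integral_const_mul,
      integral_korovkinKernel]
    field_simp
  simp only [Pi.smul_apply, smul_eq_mul]
  rw [hdiff, abs_mul, abs_of_pos (inv_pos.2 hmass), inv_mul_le_iff₀ hmass]
  calc |∫ t in -π..π, (g x - g (x - t)) * korovkinKernel n t|
      ≤ ∫ t in -π..π, |(g x - g (x - t)) * korovkinKernel n t| :=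
        intervalIntegral.abs_integral_le_integral_abs (by linarith)
    _ ≤ ∫ t in -π..π, c * (n : ℝ) ^ (-α) *
          (korovkinKernel n t + n ^ 2 * (t ^ 2 * korovkinKernel n t)) := by
        refine intervalIntegral.integral_mono_on (by linarith)
          (Continuous.intervalIntegrable (by fun_prop) _ _)
          (Continuous.intervalIntegrable (by fun_prop) _ _) fun t _ => ?_
        have hk := korovkinKernel_nonneg n t
        rw [abs_mul, abs_of_nonneg hk]
        have h1 : |g x - g (x - t)| ≤ c * ((n : ℝ) ^ (-α) * (1 + n ^ 2 * t ^ 2)) := by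
          refine (hg x (x - t)).trans ?_
          rw [sub_sub_cancel]
          exact mul_le_mul_of_nonneg_left (hpt t) hc
        refine (mul_le_mul_of_nonneg_right h1 hk).trans (le_of_eq ?_)
        ring
    _ = c * (n : ℝ) ^ (-α) *
          (korovkinMass n + n ^ 2 * ∫ t in -π..π, t ^ 2 * korovkinKernel n t) := by
        rw [intervalIntegral.integral_const_mul, intervalIntegral.integral_add
          (Continuous.intervalIntegrable (by fun_prop) _ _)
          (Continuous.intervalIntegrable (by fun_prop) _ _), intervalIntegral.integral_const_mul,
          integral_korovkinKernel]
    _ ≤ c * (n : ℝ) ^ (-α) * (korovkinMass n + n ^ 2 * (25 / n ^ 2 * korovkinMass n)) := by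
        gcongr
        exact integral_sq_mul_korovkinKernel_le hn
    _ = _ := by
        field_simp
        ring

/-- Jackson's theorem for functions whose `k`th derivative is Hölder continuous. -/
theorem exists_trigPoly_of_iteratedDeriv_holder {n : ℕ} (hn : 2 ≤ n) {α c : ℝ} (hα : 0 < α)
    (hα1 : α ≤ 1) (hc : 0 ≤ c) (k : ℕ) : ∀ F : ℝ → ℝ, Function.Periodic F (2 * π) →
      (∀ j < k, Differentiable ℝ (iteratedDeriv j F)) →
      (∀ u v : ℝ, |iteratedDeriv k F u - iteratedDeriv k F v| ≤ c * |u - v| ^ α) →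
      ∃ P ∈ trigPoly n, ∀ x, |F x - P x| ≤ c * 52 ^ (k + 1) * (n : ℝ) ^ (-(k + α)) := by
  have hn0 : 0 < (n : ℝ) := by positivity
  induction k with
  | zero =>
    intro F hper _ hF
    obtain ⟨P, hP, h⟩ := exists_trigPoly_of_holder hn hper hα hα1 hc (by simpa using hF)
    refine ⟨P, hP, fun x => (h x).trans ?_⟩
    simp only [Nat.cast_zero, zero_add, pow_one]
    have : 0 ≤ c * (n : ℝ) ^ (-α) := by positivity
    linarith
  | succ k ih =>
    intro F hper hdiff hF
    have hFd : Differentiable ℝ F := by simpa using hdiff 0 (Nat.succ_pos k)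
    have hper' : Function.Periodic (deriv F) (2 * π) := by
      intro x
      rw [← deriv_comp_add_const]
      congr 1
      exact funext hper
    obtain ⟨P, hP, hPF⟩ := ih (deriv F) hper'
      (fun j hj => by rw [← iteratedDeriv_succ']; exact hdiff (j + 1) (by omega))
      (by rw [← iteratedDeriv_succ']; exact hF)
    set E := c * 52 ^ (k + 1) * (n : ℝ) ^ (-(k + α)) with hE
    have hE0 : 0 ≤ E := by positivity
    obtain ⟨a, Q, hQ, hQd⟩ := exists_antideriv_trigPoly hP
    set D := F - Q with hD
    have hDper : Function.Periodic D (2 * π) := hper.sub (periodic_of_mem_trigPoly hQ)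
    have hDd : ∀ x, HasDerivAt D (deriv F x - (P x - a)) x :=
      fun x => (hFd x).hasDerivAt.sub (hQd x)
    -- Rolle's theorem for the periodic D gives a zero of its derivative, where the mean a is minus
    -- the approximation error of F'.
    have ha : |a| ≤ E := by
      obtain ⟨z, -, hz⟩ := exists_hasDerivAt_eq_zero (f := D) (a := 0) (b := 2 * π)
        (by positivity) (fun x _ => (hDd x).continuousAt.continuousWithinAt)
        (by simpa using (hDper 0).symm) (fun x _ => hDd x)
      have : a = -(deriv F z - P z) := by linarith
      rw [this, abs_neg]
      exact hPF z
    have hlip : ∀ u v, |D u - D v| ≤ 2 * E * |u - v| ^ (1 : ℝ) := by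
      intro u v
      rw [rpow_one]
      refine convex_univ.norm_image_sub_le_of_norm_hasDerivWithin_le
        (f' := fun x => deriv F x - (P x - a)) (fun x _ => (hDd x).hasDerivWithinAt)
        (fun x _ => ?_) (mem_univ v) (mem_univ u)
      rw [norm_eq_abs, show deriv F x - (P x - a) = (deriv F x - P x) + a by ring]
      refine (abs_add_le _ _).trans ?_
      linarith [hPF x]
    -- The remainder D is 2E-Lipschitz, so the case α = 1 gains a factor 26·2/n: one more 52 per
    -- derivative.
    obtain ⟨R, hR, hRD⟩ := exists_trigPoly_of_holder hn hDper one_pos le_rfl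
      (by positivity : 0 ≤ 2 * E) hlip
    refine ⟨Q + R, add_mem hQ hR, fun x => ?_⟩
    have : F x - (Q + R) x = D x - R x := by simp [hD]; ring
    rw [this]
    refine (hRD x).trans (le_of_eq ?_)
    rw [hE, Nat.cast_succ, show -((k : ℝ) + 1 + α) = -(k + α) + -1 by ring, rpow_add hn0]
    ring

/-! ### Trigonometric polynomials on strips -/

theorem norm_exp_le_of_abs_re_le {z : ℂ} {r : ℝ} (h : |z.re| ≤ r) : ‖Complex.exp z‖ ≤ exp r := by
  rw [Complex.norm_exp]
  exact exp_le_exp.2 ((le_abs_self _).trans h)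

theorem norm_cos_le_exp_abs_im (z : ℂ) : ‖Complex.cos z‖ ≤ exp |z.im| := by
  have h1 := norm_exp_le_of_abs_re_le (z := z * Complex.I) (r := |z.im|) (by simp)
  have h2 := norm_exp_le_of_abs_re_le (z := -z * Complex.I) (r := |z.im|) (by simp)
  rw [Complex.cos, norm_div, Complex.norm_ofNat, div_le_iff₀ (by norm_num)]
  linarith [norm_add_le (Complex.exp (z * Complex.I)) (Complex.exp (-z * Complex.I))]

theorem norm_sin_le_exp_abs_im (z : ℂ) : ‖Complex.sin z‖ ≤ exp |z.im| := by
  have h1 := norm_exp_le_of_abs_re_le (z := z * Complex.I) (r := |z.im|) (by simp)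
  have h2 := norm_exp_le_of_abs_re_le (z := -z * Complex.I) (r := |z.im|) (by simp)
  rw [Complex.sin, norm_div, norm_mul, Complex.norm_I, mul_one, Complex.norm_ofNat,
    div_le_iff₀ (by norm_num)]
  linarith [norm_sub_le (Complex.exp (-z * Complex.I)) (Complex.exp (z * Complex.I))]

/-- The size of B is irrelevant: only the exponential type m is used, to justify Phragmén–Lindelöf.
-/
theorem exists_entire_extension {m : ℕ} {P : ℝ → ℝ} (hP : P ∈ trigPoly m) :
    ∃ f : ℂ → ℂ, Differentiable ℂ f ∧ (∀ x : ℝ, f x = P x) ∧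
      ∃ B : ℝ, ∀ z, ‖f z‖ ≤ B * exp (m * |z.im|) := by
  induction hP using Submodule.span_induction with
  | mem f hf =>
    obtain ⟨k, hk, h⟩ := hf
    have hle : ∀ z : ℂ, exp |((k : ℂ) * z).im| ≤ 1 * exp (m * |z.im|) := by
      intro z
      have : ((k : ℂ) * z).im = k * z.im := by simp
      rw [this, abs_mul, Nat.abs_cast, one_mul]
      gcongr
    rcases h with rfl | rfl
    · exact ⟨fun z => Complex.cos (k * z), by fun_prop, fun x => by push_cast; rfl, 1,
        fun z => (norm_cos_le_exp_abs_im _).trans (hle z)⟩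
    · exact ⟨fun z => Complex.sin (k * z), by fun_prop, fun x => by push_cast; rfl, 1,
        fun z => (norm_sin_le_exp_abs_im _).trans (hle z)⟩
  | zero => exact ⟨0, differentiable_const 0, fun x => by simp, 0, fun z => by simp⟩
  | add P Q _ _ hP hQ =>
    obtain ⟨f, hf, hfP, B, hB⟩ := hP
    obtain ⟨g, hg, hgQ, B', hB'⟩ := hQ
    refine ⟨f + g, hf.add hg, fun x => by simp [hfP, hgQ], B + B', fun z => ?_⟩
    rw [add_mul]
    exact (norm_add_le _ _).trans (add_le_add (hB z) (hB' z))
  | smul a P _ hP =>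
    obtain ⟨f, hf, hfP, B, hB⟩ := hP
    refine ⟨(a : ℂ) • f, hf.const_smul _, fun x => by simp [hfP], |a| * B, fun z => ?_⟩
    rw [Pi.smul_apply, norm_smul, Complex.norm_real, norm_eq_abs, mul_assoc]
    exact mul_le_mul_of_nonneg_left (hB z) (abs_nonneg a)

/-- Phragmén–Lindelöf for f(iw)exp(-mw) in the right half-plane: B bounds it throughout, and D
bounds it on the imaginary axis, where the exponential has modulus 1. -/
theorem norm_le_mul_exp_of_im_nonneg {f : ℂ → ℂ} (hf : Differentiable ℂ f) {m B D : ℝ}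
    (hB : ∀ z, ‖f z‖ ≤ B * exp (m * |z.im|)) (hD : ∀ x : ℝ, ‖f x‖ ≤ D) {z : ℂ} (hz : 0 ≤ z.im) :
    ‖f z‖ ≤ D * exp (m * z.im) := by
  set g : ℂ → ℂ := fun w => f (Complex.I * w) * Complex.exp (-m * w) with hg
  have hgd : Differentiable ℂ g := by fun_prop
  have hgn : ∀ w, ‖g w‖ = ‖f (Complex.I * w)‖ * exp (-m * w.re) := by
    intro w
    simp [hg, Complex.norm_exp]
  have hgB : ∀ w : ℂ, 0 ≤ w.re → ‖g w‖ ≤ B := by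
    intro w hw
    rw [hgn]
    refine (mul_le_mul_of_nonneg_right (hB _) (exp_pos _).le).trans (le_of_eq ?_)
    rw [mul_assoc, ← exp_add]
    simp [abs_of_nonneg hw]
  have h := PhragmenLindelof.right_half_plane_of_bounded_on_real (f := g) (C := D)
    (z := -Complex.I * z) hgd.diffContOnCl ⟨0, by norm_num, 0, ?_⟩ ?_ ?_ (by simpa using hz)
  · rw [hgn, ← mul_assoc] at h
    simp only [mul_neg, Complex.I_mul_I, neg_neg, one_mul] at h
    have hre : (-Complex.I * z).re = z.im := by simp
    rw [hre] at h
    calc ‖f z‖ = ‖f z‖ * exp (-m * z.im) * exp (m * z.im) := by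
          rw [mul_assoc, ← exp_add]; simp
      _ ≤ D * exp (m * z.im) := by gcongr
  · refine Asymptotics.IsBigO.of_bound B ?_
    refine Filter.Eventually.filter_mono inf_le_right ?_
    rw [eventually_principal]
    intro w hw
    simpa using hgB w (le_of_lt hw)
  · exact isBoundedUnder_of_eventually_le (a := B)
      ((eventually_ge_atTop 0).mono fun x hx => hgB x (by simpa using hx))
  · intro x
    have : Complex.I * (x * Complex.I) = ((-x : ℝ) : ℂ) := by
      rw [mul_comm, mul_assoc, Complex.I_mul_I]; simp
    rw [hgn, this]
    simpa using hD (-x)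

/-- A trigonometric polynomial bounded on the real line has a bounded continuation to strips. -/
theorem mem_ballA_of_mem_trigPoly {m : ℕ} {P : ℝ → ℝ} (hP : P ∈ trigPoly m) {D : ℝ}
    (hD : ∀ x, |P x| ≤ D) (h : ℝ) : P ∈ ballA h (D * exp (m * h)) := by
  obtain ⟨f, hf, hfP, B, hB⟩ := exists_entire_extension hP
  refine ⟨periodic_of_mem_trigPoly hP, f, ⟨fun z _ => hf.analyticAt z, hfP⟩,
    fun z hz => ?_⟩
  have hD0 : 0 ≤ D := (abs_nonneg _).trans (hD 0)
  have hreal : ∀ x : ℝ, ‖f x‖ ≤ D := fun x => by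
    rw [hfP, Complex.norm_real]; exact hD x
  have key : ‖f z‖ ≤ D * exp (m * |z.im|) := by
    rcases le_total 0 z.im with h0 | h0
    · rw [abs_of_nonneg h0]
      exact norm_le_mul_exp_of_im_nonneg hf hB hreal h0
    · have := norm_le_mul_exp_of_im_nonneg (f := fun w => f (-w)) (z := -z) (by fun_prop)
        (fun w => by simpa using hB (-w)) (fun x => by simpa using hreal (-x)) (by simpa using h0)
      simpa [abs_of_nonpos h0] using this
  refine key.trans ?_
  gcongr

theorem ballA_mono {h r r' : ℝ} (hr : r ≤ r') : ballA h r ⊆ ballA h r' := by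
  rintro F ⟨hper, f, hf, hfr⟩
  exact ⟨hper, f, hf, fun z hz => (hfr z hz).trans hr⟩

/-! ### Fourier coefficients of functions analytic in a strip -/

/-- The (unnormalised) Fourier coefficients of a `2π`-periodic function. -/
noncomputable def fourierInt (F : ℝ → ℝ) (k : ℤ) : ℂ :=
  ∫ x in (0 : ℝ)..2 * π, (F x : ℂ) * Complex.exp (-(k * Complex.I * x))

theorem fourierInt_sub {F G : ℝ → ℝ} (hF : Continuous F) (hG : Continuous G) (k : ℤ) :
    fourierInt (F - G) k = fourierInt F k - fourierInt G k := by
  unfold fourierInt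
  rw [← intervalIntegral.integral_sub (Continuous.intervalIntegrable (by fun_prop) _ _)
    (Continuous.intervalIntegrable (by fun_prop) _ _)]
  refine intervalIntegral.integral_congr fun x _ => ?_
  simp only [Pi.sub_apply]
  push_cast
  ring

/-- A periodic function is bounded by the sum of the moduli of its Fourier coefficients. -/
theorem abs_le_tsum_norm_fourierInt {F : ℝ → ℝ} (hper : Function.Periodic F (2 * π))
    (hF : Continuous F) (hs : Summable fun k => ‖fourierInt F k‖) (x : ℝ) :
    |F x| ≤ ∑' k, ‖fourierInt F k‖ := by
  have : Fact (0 < 2 * π) := ⟨two_pi_pos⟩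
  have hper' : Function.Periodic (fun x => (F x : ℂ)) (2 * π) := fun x => by simp [hper x]
  let f : C(AddCircle (2 * π), ℂ) :=
    ⟨hper'.lift, continuous_coinduced_dom.2 (by
      change Continuous fun x => (F x : ℂ)
      fun_prop)⟩
  have hcoef : ∀ k, fourierCoeff f k = (1 / (2 * π) : ℝ) • fourierInt F k := by
    intro k
    rw [fourierCoeff_eq_intervalIntegral _ _ 0, zero_add, fourierInt]
    congr 1
    refine intervalIntegral.integral_congr fun t _ => ?_
    simp only [fourier_coe_apply, smul_eq_mul]
    have hf : f (t : AddCircle (2 * π)) = (F t : ℂ) := hper'.lift_coe t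
    rw [hf, mul_comm]
    congr 2
    have : (π : ℂ) ≠ 0 := by exact_mod_cast pi_ne_zero
    push_cast
    field_simp
  have hnorm : ∀ k, ‖fourierCoeff f k‖ ≤ ‖fourierInt F k‖ := by
    intro k
    rw [hcoef, norm_smul]
    refine mul_le_of_le_one_left (norm_nonneg _) ?_
    rw [norm_of_nonneg (by positivity), div_le_one (by positivity)]
    linarith [pi_gt_three]
  have hsum := has_pointwise_sum_fourier_series_of_summable
    (Summable.of_norm_bounded hs hnorm) (x : AddCircle (2 * π))
  have hfx : f (x : AddCircle (2 * π)) = (F x : ℂ) := hper'.lift_coe x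
  have h := tsum_of_norm_bounded hs.hasSum (f := fun k => fourierCoeff f k •
    fourier k (x : AddCircle (2 * π))) fun k => by
      rw [norm_smul, fourier_apply, Circle.norm_coe, mul_one]
      exact hnorm k
  rw [hsum.tsum_eq, hfx, Complex.norm_real] at h
  exact h

theorem continuous_of_mem_ballA {h r : ℝ} (hh : 0 ≤ h) {F : ℝ → ℝ} (hF : F ∈ ballA h r) :
    Continuous F := by
  obtain ⟨-, f, ⟨hf, hfF⟩, -⟩ := hF
  have h1 : Continuous fun x : ℝ => f x := by
    refine continuous_iff_continuousAt.2 fun x => ?_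
    exact (hf x (by simpa using hh)).continuousAt.comp Complex.continuous_ofReal.continuousAt
  have h2 : F = fun x : ℝ => (f x).re := funext fun x : ℝ => by rw [hfF, Complex.ofReal_re]
  rw [h2]
  exact Complex.continuous_re.comp h1

theorem sub_mem_ballA {h r r' : ℝ} {F G : ℝ → ℝ} (hF : F ∈ ballA h r) (hG : G ∈ ballA h r') :
    F - G ∈ ballA h (r + r') := by
  obtain ⟨hFp, f, ⟨hf, hfF⟩, hfr⟩ := hF
  obtain ⟨hGp, g, ⟨hg, hgG⟩, hgr⟩ := hG
  refine ⟨hFp.sub hGp, f - g, ⟨hf.sub hg, fun x => by simp [hfF, hgG]⟩, fun z hz => ?_⟩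
  exact (norm_sub_le _ _).trans (add_le_add (hfr z hz) (hgr z hz))

theorem convex_strip (h : ℝ) : Convex ℝ {z : ℂ | |z.im| ≤ h} := by
  have : {z : ℂ | |z.im| ≤ h} = Complex.imLm ⁻¹' (Icc (-h) h) := by
    ext z
    simp [abs_le]
  rw [this]
  exact (convex_Icc _ _).linear_preimage _

/-- The continuation of a periodic function is periodic. -/
theorem IsContinuation.add_two_pi {h : ℝ} (hh : 0 ≤ h) {F : ℝ → ℝ}
    (hper : Function.Periodic F (2 * π)) {f : ℂ → ℂ} (hf : IsContinuation h F f) {z : ℂ}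
    (hz : |z.im| ≤ h) : f (z + 2 * π) = f z := by
  have him : ∀ z : ℂ, (z + 2 * π).im = z.im := fun z => by simp
  have h1 : AnalyticOnNhd ℂ (fun z => f (z + 2 * π)) {z : ℂ | |z.im| ≤ h} := fun w hw =>
    (hf.1 (w + 2 * π) (by rw [mem_ofPred_eq, him]; exact hw)).comp_of_eq
      (analyticAt_id.add analyticAt_const) rfl
  -- Identity theorem: both sides agree on the real line, which accumulates at 0.
  refine h1.eqOn_of_preconnected_of_frequently_eq hf.1 (convex_strip h).isPreconnected
    (z₀ := 0) (by simpa using hh) ?_ hz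
  have htend : Tendsto (fun x : ℝ => (x : ℂ)) (𝓝[≠] 0) (𝓝[≠] 0) := by
    refine tendsto_nhdsWithin_iff.2 ⟨?_, ?_⟩
    · exact tendsto_nhdsWithin_of_tendsto_nhds
        (by simpa using Complex.continuous_ofReal.tendsto 0)
    · filter_upwards [self_mem_nhdsWithin] with x hx
      simpa using hx
  refine htend.frequently (Eventually.of_forall fun x => ?_).frequently
  have : (x : ℂ) + 2 * π = ((x + 2 * π : ℝ) : ℂ) := by push_cast; ring
  rw [this, hf.2, hf.2, hper]

/-- The Fourier coefficients of a function in `A_h` decay like `exp (-h |k|)`. -/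
theorem norm_fourierInt_le {h r : ℝ} (hh : 0 ≤ h) {F : ℝ → ℝ} (hF : F ∈ ballA h r) (k : ℤ) :
    ‖fourierInt F k‖ ≤ 2 * π * r * exp (-h * |(k : ℝ)|) := by
  obtain ⟨hper, f, hf, hfr⟩ := hF
  -- The contour moves to the edge Im z = σ of the strip, on the side where the exponential factor
  -- is small.
  obtain ⟨σ, hσ, hσk⟩ : ∃ σ : ℝ, |σ| ≤ h ∧ k * σ = -h * |(k : ℝ)| := by
    rcases le_total 0 (k : ℝ) with hk | hk
    · exact ⟨-h, by rw [abs_neg, abs_of_nonneg hh], by rw [abs_of_nonneg hk]; ring⟩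
    · exact ⟨h, by rw [abs_of_nonneg hh], by rw [abs_of_nonpos hk]; ring⟩
  set g : ℂ → ℂ := fun z => f z * Complex.exp (-(k * Complex.I * z)) with hg
  have hgper : ∀ z : ℂ, |z.im| ≤ h → g (z + 2 * π) = g z := by
    intro z hz
    simp only [hg]
    rw [hf.add_two_pi hh hper hz]
    congr 1
    rw [Complex.exp_eq_exp_iff_exists_int]
    exact ⟨-k, by push_cast; ring⟩
  have hgd : DifferentiableOn ℂ g {z : ℂ | |z.im| ≤ h} := by
    refine DifferentiableOn.mul (fun z hz => (hf.1 z hz).differentiableAt.differentiableWithinAt) ?_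
    exact Differentiable.differentiableOn (by fun_prop)
  have himle : ∀ y ∈ uIcc 0 σ, |y| ≤ h := by
    intro y hy
    have := abs_sub_left_of_mem_uIcc hy
    simp only [sub_zero] at this
    exact this.trans hσ
  have hrect := Complex.integral_boundary_rect_eq_zero_of_differentiableOn g 0
    (2 * π + σ * Complex.I) (hgd.mono fun z hz => by
      refine himle _ ?_
      simpa using (Complex.mem_reProdIm.1 hz).2)
  simp at hrect
  -- The vertical sides cancel by periodicity.
  have hside : ∫ y in (0 : ℝ)..σ, g (2 * π + y * Complex.I) =
      ∫ y in (0 : ℝ)..σ, g (y * Complex.I) := by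
    refine intervalIntegral.integral_congr fun y hy => ?_
    rw [add_comm, hgper _ (by simpa using himle y hy)]
  rw [hside, add_sub_cancel_right, sub_eq_zero] at hrect
  have hint : fourierInt F k = ∫ x in (0 : ℝ)..2 * π, g x := by
    refine intervalIntegral.integral_congr fun x _ => ?_
    simp only [hg, hf.2]
  rw [hint, hrect]
  have hbd : ∀ x ∈ uIoc (0 : ℝ) (2 * π), ‖g (x + σ * Complex.I)‖ ≤ r * exp (-h * |(k : ℝ)|) := by
    intro x _
    rw [hg, norm_mul, Complex.norm_exp]
    have hre : (-(k * Complex.I * (x + σ * Complex.I)) : ℂ).re = -h * |(k : ℝ)| := by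
      rw [← hσk]
      simp
    rw [hre]
    exact mul_le_mul_of_nonneg_right (hfr _ (by simpa using hσ)) (exp_pos _).le
  refine (intervalIntegral.norm_integral_le_of_norm_le_const hbd).trans (le_of_eq ?_)
  rw [sub_zero, abs_of_pos two_pi_pos]
  ring

theorem summable_exp_neg_mul_abs {a : ℝ} (ha : 0 < a) :
    Summable fun k : ℤ => exp (-a * |(k : ℝ)|) := by
  have h : Summable fun n : ℕ => exp (-a * n) := by
    simpa [mul_comm] using summable_exp_nat_mul_iff.2 (neg_neg_of_pos ha)
  refine Summable.of_nat_of_neg ?_ ?_ <;> simpa using h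

/-! ### Metric entropy of balls -/

/-- If all elements of `A` with the same code are `ε`-close, then `A` has an `ε`-net with at most
as many elements as there are codes. -/
theorem exists_isNet_of_code {β : Type*} {ε : ℝ} {A : Set (ℝ → ℝ)} (Φ : (ℝ → ℝ) → β)
    (B : Finset β) (hB : ∀ F ∈ A, Φ F ∈ B)
    (hΦ : ∀ F ∈ A, ∀ G ∈ A, Φ F = Φ G → ∀ x, |F x - G x| ≤ ε) :
    ∃ T, IsNet ε A T ∧ T.card ≤ B.card := by
  obtain ⟨s, hsA, hs⟩ := exists_subset_bijOn A Φ
  have hsB : MapsTo Φ s B := fun F hF => hB F (hsA hF)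
  have hfin : s.Finite := Finite.of_finite_image (B.finite_toSet.subset hsB.image_subset) hs.injOn
  refine ⟨hfin.toFinset, ⟨fun G hG => hsA (hfin.mem_toFinset.1 hG), fun F hF => ?_⟩, ?_⟩
  · obtain ⟨G, hG, hGF⟩ := hs.surjOn (mem_image_of_mem Φ hF)
    exact ⟨G, hfin.mem_toFinset.2 hG, hΦ F hF G (hsA hG) hGF.symm⟩
  · exact Finset.card_le_card_of_injOn Φ (fun F hF => hsB (hfin.mem_toFinset.1 hF))
      (fun F hF G hG => hs.injOn (hfin.mem_toFinset.1 hF) (hfin.mem_toFinset.1 hG))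

theorem abs_sub_le_of_floor_eq {η a b : ℝ} (hη : 0 < η) (h : ⌊a / η⌋ = ⌊b / η⌋) :
    |a - b| ≤ η := by
  have := Int.abs_sub_lt_one_of_floor_eq_floor h
  rw [← sub_div, abs_div, abs_of_pos hη, div_lt_one hη] at this
  exact this.le

theorem floor_div_mem_Icc {η a R : ℝ} (hη : 0 < η) (ha : |a| ≤ R) :
    ⌊a / η⌋ ∈ Finset.Icc (-⌈R / η⌉) ⌈R / η⌉ := by
  rw [abs_le] at ha
  rw [Finset.mem_Icc, ← Int.floor_neg, ← neg_div]
  constructor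
  · exact Int.floor_mono (by gcongr; exact ha.1)
  · exact (Int.floor_mono (by gcongr; exact ha.2)).trans (Int.floor_le_ceil _)

/-- Rounding the Fourier coefficients of low frequency yields nets of balls in `A_h`. -/
theorem exists_isNet_ballA {h M ε : ℝ} (hh : 0 < h) (hM : 0 < M) (hε : 0 < ε) (n : ℕ)
    (hn : 4 * π * M * (∑' k : ℤ, exp (-(h / 2) * |(k : ℝ)|)) * exp (-(h / 2) * n) ≤ ε / 2) :
    ∃ T, IsNet ε (ballA h M) T ∧
      T.card ≤ ((2 * ⌈8 * π * M * (2 * n + 1) / ε⌉₊ + 1) ^ 2) ^ (2 * n + 1) := by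
  classical
  -- Each of the 2n + 1 low frequencies contributes at most 2η (real and imaginary parts), ε/2 in
  -- all; the other ε/2 is left for the tail.
  set η := ε / (4 * (2 * n + 1)) with hη
  have hη0 : 0 < η := by positivity
  set R := ⌈2 * π * M / η⌉ with hR
  let Φ : (ℝ → ℝ) → Finset.Icc (-(n : ℤ)) n → ℤ × ℤ := fun F k =>
    (⌊(fourierInt F k).re / η⌋, ⌊(fourierInt F k).im / η⌋)
  have hcoefM : ∀ F ∈ ballA h M, ∀ k, ‖fourierInt F k‖ ≤ 2 * π * M := by
    intro F hF k
    refine (norm_fourierInt_le hh.le hF k).trans (mul_le_of_le_one_right (by positivity) ?_)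
    rw [exp_le_one_iff]
    nlinarith [abs_nonneg (k : ℝ)]
  have hB : ∀ F ∈ ballA h M, Φ F ∈
      Fintype.piFinset fun _ => Finset.Icc (-R) R ×ˢ Finset.Icc (-R) R := by
    intro F hF
    rw [Fintype.mem_piFinset]
    intro k
    have hk := hcoefM F hF k
    exact Finset.mem_product.2
      ⟨floor_div_mem_Icc hη0 ((Complex.abs_re_le_norm _).trans hk),
        floor_div_mem_Icc hη0 ((Complex.abs_im_le_norm _).trans hk)⟩
  have hΦ : ∀ F ∈ ballA h M, ∀ G ∈ ballA h M, Φ F = Φ G → ∀ x, |F x - G x| ≤ ε := by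
    intro F hF G hG hFG x
    have hD := sub_mem_ballA hF hG
    have hFc := continuous_of_mem_ballA hh.le hF
    have hGc := continuous_of_mem_ballA hh.le hG
    set S := ∑' k : ℤ, exp (-(h / 2) * |(k : ℝ)|) with hS
    have hS' := summable_exp_neg_mul_abs (half_pos hh)
    -- For |k| > n the decay exp(-h|k|) is split in two: one half gives the small factor exp(-hn/2),
    -- the other keeps the series summable.
    set b : ℤ → ℝ := fun k => (if k ∈ Finset.Icc (-(n : ℤ)) n then 2 * η else 0) +
      4 * π * M * exp (-(h / 2) * n) * exp (-(h / 2) * |(k : ℝ)|) with hb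
    have hbs : HasSum b ((2 * n + 1) * (2 * η) + 4 * π * M * exp (-(h / 2) * n) * S) := by
      refine HasSum.add ?_ (hS'.hasSum.mul_left _)
      have : HasSum (fun k : ℤ => if k ∈ Finset.Icc (-(n : ℤ)) n then 2 * η else 0)
          (∑ k ∈ Finset.Icc (-(n : ℤ)) n, if k ∈ Finset.Icc (-(n : ℤ)) n then 2 * η else 0) :=
        hasSum_sum_of_ne_finset_zero fun k hk => if_neg hk
      rw [Finset.sum_congr rfl fun k hk => if_pos hk, Finset.sum_const, Int.card_Icc,
        nsmul_eq_mul] at this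
      have e : ((n : ℤ) + 1 - -n).toNat = 2 * n + 1 := by omega
      rw [e] at this
      exact_mod_cast this
    have hcoef : ∀ k, ‖fourierInt (F - G) k‖ ≤ b k := by
      intro k
      by_cases hk : k ∈ Finset.Icc (-(n : ℤ)) n
      · have hk' := congrFun hFG ⟨k, hk⟩
        simp only [Φ, Prod.mk.injEq] at hk'
        have h1 := abs_sub_le_of_floor_eq hη0 hk'.1
        have h2 := abs_sub_le_of_floor_eq hη0 hk'.2
        have h3 : 0 ≤ 4 * π * M * exp (-(h / 2) * n) * exp (-(h / 2) * |(k : ℝ)|) := by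
          positivity
        rw [fourierInt_sub hFc hGc]
        refine (Complex.norm_le_abs_re_add_abs_im _).trans ?_
        simp only [hb, if_pos hk, Complex.sub_re, Complex.sub_im]
        linarith
      · simp only [hb, if_neg hk, zero_add]
        refine (norm_fourierInt_le hh.le hD k).trans ?_
        have hkn : (n : ℝ) ≤ |(k : ℝ)| := by
          rw [Finset.mem_Icc, ← abs_le, not_le] at hk
          exact_mod_cast hk.le
        rw [show 2 * π * (M + M) = 4 * π * M by ring, mul_assoc _ (exp _), ← exp_add]
        gcongr
        nlinarith
    have hsum : Summable fun k => ‖fourierInt (F - G) k‖ :=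
      Summable.of_nonneg_of_le (fun _ => norm_nonneg _) hcoef hbs.summable
    have h1 := abs_le_tsum_norm_fourierInt hD.1 (hFc.sub hGc) hsum x
    have h2 := hsum.tsum_le_tsum hcoef hbs.summable
    rw [hbs.tsum_eq] at h2
    have h3 : (2 * n + 1) * (2 * η) = ε / 2 := by rw [hη]; field_simp; ring
    simp only [Pi.sub_apply] at h1
    linarith
  obtain ⟨T, hT, hcard⟩ := exists_isNet_of_code (ε := ε) (A := ballA h M) Φ
    (Fintype.piFinset fun _ => Finset.Icc (-R) R ×ˢ Finset.Icc (-R) R) hB hΦ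
  refine ⟨T, hT, hcard.trans (le_of_eq ?_)⟩
  rw [Fintype.card_piFinset, Finset.prod_const, Finset.card_univ, Fintype.card_coe,
    Finset.card_product, Int.card_Icc, Int.card_Icc, ← sq]
  have h1 : 2 * π * M / η = 8 * π * M * (2 * n + 1) / ε := by
    rw [hη]; field_simp; ring
  have h2 : R = (⌈8 * π * M * (2 * n + 1) / ε⌉₊ : ℤ) := by
    rw [hR, h1, Int.natCast_ceil_eq_ceil (by positivity)]
  rw [h2]
  congr 2 <;> omega

theorem exists_isMinimalNet {ε : ℝ} {A : Set (ℝ → ℝ)} (h : ∃ T, IsNet ε A T) :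
    ∃ T, IsMinimalNet ε A T := by
  obtain ⟨T, hT, hmin⟩ := WellFounded.has_min (measure Finset.card).wf {T | IsNet ε A T} h
  exact ⟨T, hT, fun T' hT' => not_lt.1 (hmin T' hT')⟩

/-- The metric entropy of balls in `A_h`. -/
theorem log_card_isMinimalNet_le {h : ℝ} (hh : 0 < h) :
    ∃ p₀ : ℕ, ∀ i j : ℕ, p₀ ≤ i + j + 2 → ∀ T : Finset (ℝ → ℝ),
      IsMinimalNet ((1 / 2 : ℝ) ^ (j + 1)) (ballA h (2 ^ (i + 1))) T →
        log T.card ≤ 20 * (i + j + 2 : ℕ) ^ 2 / h := by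
  set S := ∑' k : ℤ, exp (-(h / 2) * |(k : ℝ)|) with hS
  have hS0 : 0 ≤ S := tsum_nonneg fun _ => (exp_pos _).le
  -- With n ≥ 2p/h the tail is O(2^p·ε·exp(-p)), hence negligible against ε because 2 < e.
  have e1 : ∀ᶠ p : ℕ in atTop, 8 * π * S * (2 * exp (-1)) ^ p ≤ 1 := by
    have h2 : 2 * exp (-1) < 1 := by
      rw [exp_neg, ← div_eq_mul_inv, div_lt_one (exp_pos _)]
      linarith [exp_one_gt_d9]
    have := (tendsto_pow_atTop_nhds_zero_of_lt_one (by positivity) h2).const_mul (8 * π * S)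
    rw [mul_zero] at this
    exact this.eventually_le_const one_pos
  have e2 : ∀ᶠ p : ℕ in atTop, 3 ≤ (p : ℝ) / h :=
    (tendsto_natCast_atTop_atTop.atTop_div_const hh).eventually_ge_atTop 3
  have e3 : ∀ᶠ p : ℕ in atTop, 80 * π / h * p + 3 ≤ (2 : ℝ) ^ p := by
    have t1 := (tendsto_self_mul_const_pow_of_lt_one (r := (1 / 2 : ℝ)) (by norm_num)
      (by norm_num)).const_mul (80 * π / h)
    have t2 := (tendsto_pow_atTop_nhds_zero_of_lt_one (r := (1 / 2 : ℝ)) (by norm_num)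
      (by norm_num)).const_mul 3
    have t3 := t1.add t2
    rw [mul_zero, mul_zero, add_zero] at t3
    filter_upwards [t3.eventually_le_const one_pos] with p hp
    have h2 : (0 : ℝ) < 2 ^ p := by positivity
    rw [one_div, inv_pow] at hp
    have := mul_le_mul_of_nonneg_right hp h2.le
    field_simp at this ⊢
    linarith
  obtain ⟨p₀, hp₀⟩ := eventually_atTop.1 (e1.and (e2.and e3))
  refine ⟨p₀, fun i j hij T hT => ?_⟩
  obtain ⟨h1, h2, h3⟩ := hp₀ _ hij
  generalize hp : i + j + 2 = p at h1 h2 h3 ⊢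
  have hpow : (2 : ℝ) ^ (i + 1) = 2 ^ p * (1 / 2) ^ (j + 1) := by
    have : p = (i + 1) + (j + 1) := by omega
    rw [this, pow_add _ (i + 1) (j + 1), mul_assoc, ← mul_pow]
    norm_num
  set ε : ℝ := (1 / 2 : ℝ) ^ (j + 1) with hε
  have hε0 : 0 < ε := by positivity
  set n := ⌈2 * p / h⌉₊ with hn
  have hn1 : 2 * p / h ≤ n := Nat.le_ceil _
  have hn2 : (n : ℝ) < 2 * p / h + 1 := Nat.ceil_lt_add_one (by positivity)
  have hn3 : 2 * (n : ℝ) + 1 ≤ 5 * (p / h) := by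
    rw [mul_div_assoc] at hn2
    linarith
  obtain ⟨T', hT', hcard⟩ := exists_isNet_ballA (M := 2 ^ (i + 1)) (ε := ε) hh (by positivity)
    hε0 n (by
      have : exp (-(h / 2) * n) ≤ exp (-1) ^ p := by
        rw [← exp_nat_mul, exp_le_exp]
        rw [div_le_iff₀ hh] at hn1
        linarith
      calc 4 * π * 2 ^ (i + 1) * S * exp (-(h / 2) * n)
          ≤ 4 * π * 2 ^ (i + 1) * S * exp (-1) ^ p := by gcongr
        _ = ε / 2 * (8 * π * S * (2 * exp (-1)) ^ p) := by rw [hpow, mul_pow]; ring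
        _ ≤ ε / 2 * 1 := by gcongr
        _ = ε / 2 := mul_one _)
  have hle : T.card ≤ ((2 * ⌈8 * π * 2 ^ (i + 1) * (2 * n + 1) / ε⌉₊ + 1) ^ 2) ^ (2 * n + 1) :=
    (hT.2 T' hT').trans hcard
  -- The ratio of radius to accuracy is 2^p, and `e3` lets a second 2^p absorb the factor linear in
  -- p/h.
  have hbase : (2 * ⌈8 * π * 2 ^ (i + 1) * (2 * n + 1) / ε⌉₊ + 1 : ℝ) ≤ 4 ^ p := by
    have h4 : 8 * π * 2 ^ (i + 1) * (2 * n + 1) / ε = 2 ^ p * (8 * π * (2 * n + 1)) := by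
      rw [hpow]; field_simp
    have h5 := (Nat.ceil_lt_add_one
      (show 0 ≤ 8 * π * 2 ^ (i + 1) * (2 * n + 1) / ε by positivity)).le
    have h6 : (1 : ℝ) ≤ 2 ^ p := one_le_pow₀ (by norm_num)
    rw [h4] at h5 ⊢
    calc _ ≤ 2 * (2 ^ p * (8 * π * (2 * n + 1)) + 1) + 1 := by linarith
      _ ≤ 2 * (2 ^ p * (8 * π * (5 * (p / h)))) + 3 * 2 ^ p := by
        have : (2 : ℝ) ^ p * (8 * π * (2 * n + 1)) ≤ 2 ^ p * (8 * π * (5 * (p / h))) := by gcongr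
        linarith
      _ = 2 ^ p * (80 * π / h * p + 3) := by ring
      _ ≤ 2 ^ p * 2 ^ p := by gcongr
      _ = 4 ^ p := by rw [← mul_pow]; norm_num
  rcases Nat.eq_zero_or_pos T.card with h0 | hpos
  · rw [h0, Nat.cast_zero, log_zero]
    positivity
  · have hle' : (T.card : ℝ) ≤ ((4 ^ p) ^ 2) ^ (2 * n + 1) := by
      calc (T.card : ℝ) ≤
          ((2 * ⌈8 * π * 2 ^ (i + 1) * (2 * n + 1) / ε⌉₊ + 1 : ℝ) ^ 2) ^ (2 * n + 1) := by
            exact_mod_cast hle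
        _ ≤ _ := by gcongr
    have hlog := log_le_log (by exact_mod_cast hpos) hle'
    rw [log_pow, log_pow, log_pow] at hlog
    have hlog4 : log 4 ≤ 2 := by
      have : (4 : ℝ) = 2 ^ 2 := by norm_num
      rw [this, log_pow]
      have := log_two_lt_d9
      push_cast
      linarith
    refine hlog.trans ?_
    push_cast
    calc (2 * (n : ℝ) + 1) * (2 * (p * log 4)) ≤ 5 * (p / h) * (2 * (p * 2)) := by gcongr
      _ = 20 * p ^ 2 / h := by ring

/-- Shows that the strategy exists. Every i and j must be covered, so n is merely taken large,
without a quantitative choice. -/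
theorem exists_isNetSystem {h : ℝ} (hh : 0 < h) :
    ∃ net : ℕ → ℕ → Finset (ℝ → ℝ), IsNetSystem h net := by
  have key : ∀ i j : ℕ, ∃ T,
      IsMinimalNet ((1 / 2 : ℝ) ^ (j + 1)) (ballA h (2 ^ (i + 1))) T := by
    intro i j
    have ht : Tendsto (fun n : ℕ => 4 * π * 2 ^ (i + 1) * (∑' k : ℤ, exp (-(h / 2) * |(k : ℝ)|)) *
        exp (-(h / 2) * n)) atTop (𝓝 0) := by
      rw [← mul_zero (4 * π * 2 ^ (i + 1) * (∑' k : ℤ, exp (-(h / 2) * |(k : ℝ)|)))]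
      refine Tendsto.const_mul _ (tendsto_exp_atBot.comp ?_)
      exact tendsto_natCast_atTop_atTop.const_mul_atTop_of_neg (by linarith)
    obtain ⟨n, hn⟩ := (ht.eventually_le_const
      (show (0 : ℝ) < (1 / 2) ^ (j + 1) / 2 by positivity)).exists
    obtain ⟨T, hT, -⟩ := exists_isNet_ballA hh (by positivity) (by positivity) n hn
    exact exists_isMinimalNet ⟨T, hT⟩
  choose net hnet using key
  exact ⟨net, hnet⟩

/-! ### Balancing approximation and entropy -/

theorem exists_forall_abs_le_of_periodic {F : ℝ → ℝ} (hper : Function.Periodic F (2 * π))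
    (hF : Continuous F) : ∃ D, 0 ≤ D ∧ ∀ x, |F x| ≤ D := by
  obtain ⟨D, hD⟩ := isCompact_Icc.exists_bound_of_continuousOn
    (s := Icc (0 : ℝ) (2 * π)) hF.continuousOn
  refine ⟨D, (abs_nonneg _).trans (hD 0 ⟨le_rfl, two_pi_pos.le⟩), fun x => ?_⟩
  obtain ⟨y, hy, hxy⟩ := hper.exists_mem_Ico₀ two_pi_pos x
  rw [hxy]
  exact hD y (Ico_subset_Icc_self hy)

/-- The regret against `F`, in terms of the accuracy of trigonometric approximation of `F`: here
`q` is proportional to the degree of the approximating polynomial. -/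
theorem regret_le_of_trigPoly {h : ℝ} (hh : 0 < h) {net : ℕ → ℕ → Finset (ℝ → ℝ)}
    (hnet : IsNetSystem h net) {p₀ : ℕ}
    (hent : ∀ i j : ℕ, p₀ ≤ i + j + 2 → ∀ T : Finset (ℝ → ℝ),
      IsMinimalNet ((1 / 2 : ℝ) ^ (j + 1)) (ballA h (2 ^ (i + 1))) T →
        log T.card ≤ 20 * (i + j + 2 : ℕ) ^ 2 / h)
    {F P : ℝ → ℝ} {D δ q : ℝ} {m N : ℕ} (hN : 1 ≤ N) (hP : P ∈ trigPoly m) (hD1 : 1 ≤ D)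
    (hD : ∀ x, |P x| ≤ D) (hFP : ∀ x, |F x - P x| ≤ δ) (hNδ : N * δ ≤ 52 * (h * q ^ 2))
    (hq : 1 ≤ q) (hqm : q ≤ m) (hmq : m ≤ 53 * q) (hhq : 4 ≤ h * q) (hp₀ : p₀ ≤ h * q)
    (hlog : 2 * log D + 2 * log N + 4 ≤ h * q) {x y : ℕ → ℝ} (hy : ∀ n, |y n| ≤ 1) :
    ∑ n ∈ Finset.range N, (y n - prediction (banachStrategy net) x y n) ^ 2 ≤
      ∑ n ∈ Finset.range N, (y n - F (x n)) ^ 2 + 5000000 * (h * q ^ 2) := by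
  have hN0 : (0 : ℝ) < N := by exact_mod_cast hN
  have hlogN : 0 ≤ log N := log_natCast_nonneg N
  have hlogD : 0 ≤ log D := log_nonneg hD1
  -- The factors 2 here and in `j` convert powers of e to powers of 2, as log 2 > 1/2. The ball then
  -- contains P, and the net accuracy is at most 1/N.
  set i := ⌈2 * (log D + m * h)⌉₊ with hi
  set j := ⌈2 * log N⌉₊ with hj
  have hi1 : 2 * (log D + m * h) ≤ i := Nat.le_ceil _
  have hi2 : (i : ℝ) < 2 * (log D + m * h) + 1 := Nat.ceil_lt_add_one (by positivity)
  have hj1 : 2 * log N ≤ j := Nat.le_ceil _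
  have hj2 : (j : ℝ) < 2 * log N + 1 := Nat.ceil_lt_add_one (by positivity)
  have hpow : ∀ n : ℕ, exp (n / 2) ≤ 2 ^ (n + 1) := by
    intro n
    rw [← exp_log (show (0 : ℝ) < 2 ^ (n + 1) by positivity), exp_le_exp, log_pow]
    have := log_two_gt_d9
    push_cast
    nlinarith [Nat.cast_nonneg (α := ℝ) n]
  have hPi : P ∈ ballA h (2 ^ (i + 1)) := by
    refine ballA_mono ?_ (mem_ballA_of_mem_trigPoly hP hD h)
    refine le_trans ?_ (hpow i)
    rw [← exp_log (show 0 < D by linarith), ← exp_add, exp_le_exp]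
    linarith
  have hjN : N * (1 / 2 : ℝ) ^ (j + 1) ≤ 1 := by
    rw [one_div, inv_pow, mul_inv_le_iff₀ (by positivity), one_mul]
    refine le_trans ?_ (hpow j)
    rw [← log_le_iff_le_exp hN0]
    linarith
  obtain ⟨G, hG, hPG⟩ := (hnet i j).1.2 P hPi
  have hFG : ∀ x, |F x - G x| ≤ δ + (1 / 2 : ℝ) ^ (j + 1) := fun x =>
    (abs_sub_le _ _ _).trans (add_le_add (hFP x) (hPG x))
  have hreg := sum_sq_banachStrategy_le net hG hFG N (x := x) hy
  have hmh : h * q ≤ m * h := by nlinarith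
  have hmh' : m * h ≤ 53 * (h * q) := by nlinarith
  have hent' := hent i j (by
    have : (p₀ : ℝ) ≤ i + j + 2 := by linarith [Nat.cast_nonneg (α := ℝ) j]
    exact_mod_cast this) _ (hnet i j)
  have hp : ((i + j + 2 : ℕ) : ℝ) ≤ 159 * (h * q) := by
    push_cast
    linarith
  have hp2 : 20 * ((i + j + 2 : ℕ) : ℝ) ^ 2 / h ≤ 20 * (159 * (h * q)) ^ 2 / h := by gcongr
  have hp3 : 20 * (159 * (h * q)) ^ 2 / h = 505620 * (h * q ^ 2) := by
    field_simp
    ring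
  have hqq : h * q ≤ h * q ^ 2 := by nlinarith
  push_cast at hp
  nlinarith

theorem continuous_of_iteratedDeriv_holder {k : ℕ} {α c : ℝ} (hα : 0 < α) {F : ℝ → ℝ}
    (hdiff : ∀ j < k, Differentiable ℝ (iteratedDeriv j F))
    (hF : ∀ u v : ℝ, |iteratedDeriv k F u - iteratedDeriv k F v| ≤ c * |u - v| ^ α) :
    Continuous F := by
  rcases Nat.eq_zero_or_pos k with rfl | hk
  · exact continuous_of_holder hα (by simpa using hF)
  · simpa using (hdiff 0 hk).continuous

end OnlineRegression

open OnlineRegression Filter in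
theorem corollary11 :
    ∃ C : ℝ, 0 < C ∧ ∀ h : ℝ, 0 < h →
      (∃ net : ℕ → ℕ → Finset (ℝ → ℝ), OnlineRegression.IsNetSystem h net) ∧
      ∀ net : ℕ → ℕ → Finset (ℝ → ℝ), OnlineRegression.IsNetSystem h net →
        ∀ (k : ℕ) (α c : ℝ), 0 < α → α ≤ 1 → 0 < c →
          ∀ F : ℝ → ℝ, Function.Periodic F (2 * Real.pi) →
            (∀ j < k, Differentiable ℝ (iteratedDeriv j F)) →
            (∀ u v : ℝ, |iteratedDeriv k F u - iteratedDeriv k F v| ≤ c * |u - v| ^ α) →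
            ∃ N₀ : ℕ, ∀ N : ℕ, N₀ ≤ N → ∀ x y : ℕ → ℝ, (∀ n, |y n| ≤ 1) →
              ∑ n ∈ Finset.range N,
                  (y n - OnlineRegression.prediction
                    (OnlineRegression.banachStrategy net) x y n) ^ 2 ≤
                ∑ n ∈ Finset.range N, (y n - F (x n)) ^ 2 +
                  C * h ^ (((k : ℝ) + α) / ((k : ℝ) + α + 2)) *
                    c ^ (2 / ((k : ℝ) + α + 2)) * (N : ℝ) ^ (2 / ((k : ℝ) + α + 2)) := by
  refine ⟨5000000, by norm_num, fun h hh => ⟨exists_isNetSystem hh, ?_⟩⟩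
  intro net hnet k α c hα hα1 hc F hper hdiff hF
  obtain ⟨p₀, hent⟩ := log_card_isMinimalNet_le hh
  obtain ⟨D₀, hD₀, hFD⟩ :=
    exists_forall_abs_le_of_periodic hper (continuous_of_iteratedDeriv_holder hα hdiff hF)
  set s : ℝ := (k : ℝ) + α with hs
  have hs0 : 0 < s := by positivity
  -- Bounds every approximant P used below, whose error is at most 52c once q ≥ 1; the 1 makes log D
  -- nonnegative.
  set D := D₀ + 52 * c + 1 with hD
  set r : ℝ := 1 / (s + 2) with hr
  have hr0 : 0 < r := by positivity
  set κ : ℝ := h * (c / h) ^ r with hκ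
  have hκ0 : 0 < κ := by positivity
  have hpowt : Tendsto (fun N : ℕ => (N : ℝ) ^ r) atTop atTop :=
    (tendsto_rpow_atTop hr0).comp tendsto_natCast_atTop_atTop
  have hqt : Tendsto (fun N : ℕ => κ * (N : ℝ) ^ r) atTop atTop := hpowt.const_mul_atTop hκ0
  have elog : ∀ᶠ N : ℕ in atTop, Real.log N ≤ κ / 4 * (N : ℝ) ^ r := by
    have h1 := (isLittleO_log_rpow_atTop hr0).bound (show 0 < κ / 4 by positivity)
    filter_upwards [tendsto_natCast_atTop_atTop.eventually h1] with N hN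
    rw [Real.norm_eq_abs, Real.norm_of_nonneg (by positivity)] at hN
    exact (le_abs_self _).trans hN
  -- Since κ·N^r equals h·q, these conditions say that h·q exceeds h (so q ≥ 1), 4, p₀ and the
  -- logarithmic terms.
  obtain ⟨N₀, hN₀⟩ := eventually_atTop.1 (elog.and ((eventually_ge_atTop 1).and
    ((hqt.eventually_ge_atTop (max h (max 4 p₀))).and
      (hqt.eventually_ge_atTop (4 * Real.log D + 8)))))
  refine ⟨N₀, fun N hN x y hy => ?_⟩
  obtain ⟨h1, hN1, h2, h3⟩ := hN₀ N hN
  have hN0 : (0 : ℝ) < N := by exact_mod_cast hN1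
  set q : ℝ := (N * c / h) ^ r with hq
  have hκq : κ * (N : ℝ) ^ r = h * q := by
    rw [hκ, hq, mul_assoc, ← Real.mul_rpow (by positivity) (by positivity)]
    congr 2
    ring
  rw [hκq, max_le_iff, max_le_iff] at h2
  have h1' : 4 * Real.log N ≤ h * q := by rw [← hκq]; linarith
  rw [hκq] at h3
  have hq1 : 1 ≤ q := by nlinarith [h2.1]
  have hq0 : 0 < q := by linarith
  have hqs : q ^ (s + 2) = N * c / h := by
    rw [hq, ← Real.rpow_mul (by positivity), hr, one_div_mul_cancel (by positivity), Real.rpow_one]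
  have hrate : h * q ^ 2 = h ^ (s / (s + 2)) * c ^ (2 / (s + 2)) * (N : ℝ) ^ (2 / (s + 2)) := by
    have e1 : q ^ 2 = (N * c / h) ^ (2 / (s + 2)) := by
      rw [hq, ← Real.rpow_natCast, ← Real.rpow_mul (by positivity), hr]
      congr 1
      push_cast
      ring
    have e2 : s / (s + 2) = 1 - 2 / (s + 2) := by field_simp; ring
    rw [e1, e2, Real.div_rpow (by positivity) hh.le, Real.mul_rpow hN0.le hc.le,
      Real.rpow_sub hh, Real.rpow_one]
    ring
  -- The factor 52 makes m^(-s) supply 52^(-s) ≤ 52^(-k), cancelling the growth of Jackson's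
  -- constant with k.
  set m := ⌈52 * q⌉₊ with hm
  have hm1 : 52 * q ≤ m := Nat.le_ceil _
  have hm2 : (m : ℝ) < 52 * q + 1 := Nat.ceil_lt_add_one (by positivity)
  have hm3 : 2 ≤ m := by
    have : (2 : ℝ) ≤ m := by linarith
    exact_mod_cast this
  obtain ⟨P, hP, hFP⟩ :=
    exists_trigPoly_of_iteratedDeriv_holder hm3 hα hα1 hc.le k F hper hdiff hF
  have hδ : c * 52 ^ (k + 1) * (m : ℝ) ^ (-s) ≤ 52 * c * q ^ (-s) := by
    have e1 : (m : ℝ) ^ (-s) ≤ (52 * q) ^ (-s) :=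
      Real.rpow_le_rpow_of_nonpos (by positivity) hm1 (by linarith)
    have e2 : (52 : ℝ) ^ k ≤ 52 ^ s := by
      rw [← Real.rpow_natCast]
      exact Real.rpow_le_rpow_of_exponent_le (by norm_num) (by linarith)
    calc c * 52 ^ (k + 1) * (m : ℝ) ^ (-s) ≤ c * 52 ^ (k + 1) * (52 * q) ^ (-s) := by gcongr
      _ = 52 * c * q ^ (-s) * (52 ^ k * 52 ^ (-s)) := by
        rw [Real.mul_rpow (by norm_num) hq0.le, pow_succ]
        ring
      _ ≤ 52 * c * q ^ (-s) * (52 ^ s * 52 ^ (-s)) := by gcongr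
      _ = 52 * c * q ^ (-s) := by
        rw [← Real.rpow_add (by norm_num), add_neg_cancel, Real.rpow_zero, mul_one]
  have hδD : 52 * c * q ^ (-s) ≤ 52 * c :=
    mul_le_of_le_one_right (by positivity) (Real.rpow_le_one_of_one_le_of_nonpos hq1 (by linarith))
  have hNδ : N * (52 * c * q ^ (-s)) = 52 * (h * q ^ 2) := by
    have e1 : (N : ℝ) * c = h * q ^ (s + 2) := by rw [hqs]; field_simp
    have e2 : q ^ (s + 2) * q ^ (-s) = q ^ 2 := by
      rw [← Real.rpow_add hq0, ← Real.rpow_natCast]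
      congr 1
      push_cast
      ring
    calc N * (52 * c * q ^ (-s)) = 52 * (N * c * q ^ (-s)) := by ring
      _ = 52 * (h * q ^ 2) := by rw [e1, mul_assoc, e2]
  have hPD : ∀ x, |P x| ≤ D := by
    intro x
    have := abs_sub_abs_le_abs_sub (P x) (F x)
    rw [abs_sub_comm] at this
    linarith [hFD x, hFP x]
  have key := regret_le_of_trigPoly hh hnet hent hN1 hP (by linarith : (1 : ℝ) ≤ D) hPD
    (fun x => (hFP x).trans hδ) hNδ.le hq1 (by linarith) (by linarith) h2.2.1 h2.2.2
    (by linarith) (x := x) hy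
  rw [hrate] at key
  refine key.trans (le_of_eq ?_)
  ring
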